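/- **Theorem (Stability of risk-aware LQG control).** Let $A\in\mathbb R^{n\times n}$, $B\in\mathbb R^{n\times p}$, $C\in\mathbb R^{m\times n}$, $\mu\ge 0$, and let $Q\in\mathbb R^{n\times n}$, $R\in\mathbb R^{p\times p}$ be symmetric positive definite. A square matrix is called *stable* if its spectral radius is less than $1$. Let the process and measurement noises $(w_k,v_k)_{k\in\mathbb Z}$, with values in $\mathbb R^n\times\mathbb R^m$, be jointly Gaussian for each $k$ and i.i.d. over $k$, with means $\bar w$ and $0$ and covariance $\begin{pmatrix}W&0\\0&S\end{pmatrix}$. Assume that $(A,B)$ is stabilizable, $(A,Q^{1/2})$ is detectable, $(A,C)$ is detectable, $(A,W^{1/2})$ is stabilizable, and $S\succ0$. For integers $t_0<N$ consider, for $t\in\{t_0,\dots,N-1\}$, the forward recursion $$W_{t_0}=0,\qquad W_{t+1}=AW_tA'+W-AW_tC'(CW_tC'+S)^{-1}CW_tA',$$ put $Q_{\mu,t}=Q+4\mu QW_tQ$, and consider the backward recursions with $V_{N-1}=Q_{\mu,N-1}$, $\xi_{N-1}=0$, $$K_t=-(B'V_tB+R)^{-1}B'V_tA,\qquad V_{t-1}=(A+BK_t)'V_t(A+BK_t)+K_t'RK_t+Q_{\mu,t-1},$$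 $$\xi_{t-1}=(A+BK_t)'(\xi_t+V_t\bar w),\qquad l_t=-(B'V_tB+R)^{-1}B'\xi_t,\qquad l_t^{*}=-(B'V_tB+R)^{-1}B'(\xi_t+V_t\bar w).$$ Then the filter Riccati equation $$W_\infty=AW_\infty A'+W-AW_\infty C'(CW_\infty C'+S)^{-1}CW_\infty A'$$ has a unique stabilizing solution (a symmetric solution with $CW_\infty C'+S$ invertible and $A-AW_\infty C'(CW_\infty C'+S)^{-1}C$ stable). With $Q_{\mu,\infty}=Q+4\mu QW_\infty Q$, the control Riccati equation $$V=A'VA+Q_{\mu,\infty}-A'VB(B'VB+R)^{-1}B'VA$$ has a unique stabilizing solution (a symmetric solution with $B'VB+R$ invertible and $A+BK$ stable, where $K=-(B'VB+R)^{-1}B'VA$). In particular $\bar A=A+BK$ is stable. Moreover, with $\|\cdot\|$ the spectral norm of matrices and the Euclidean norm of vectors: 1. There are constants $\mathcal C_1,\mathcal C_2>0$, independent of $t_0,N,t$, such that for all integers $t_0\le t\le N-1$ $$\|V_t-V\|\le \mathcal C_1\|\bar A^{\,N-t-1}\|+\mathcal C_2\|W_t-W_\infty\|.$$ 2. As $N\to\infty$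 and $t_0\to-\infty$, the quantities $W_t,V_t,K_t,\xi_t,l_t,l_t^*$ converge exponentially fast to $W_\infty$, $V$, $K$, $\xi=(I-\bar A')^{-1}\bar A'V\bar w$, $-(B'VB+R)^{-1}B'\xi$ and $-(B'VB+R)^{-1}B'(\xi+V\bar w)$, respectively: there are $c>0$ and $\rho\in(0,1)$, independent of $t_0,N,t$, such that for all $t_0\le t\le N-1$ $$\|W_t-W_\infty\|\le c\,\rho^{\,t-t_0},$$ and the distance of each of $V_t,K_t,\xi_t,l_t,l_t^*$ from its limit is at most $c\,(\rho^{\,N-1-t}+\rho^{\,t-t_0})$. -/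

import Mathlib

open scoped Matrix Matrix.Norms.L2Operator MatrixOrder

namespace RiskLQG

/-- Schur stability of a real square matrix: the (complex) spectral radius is less than one. -/
def IsStable {n : ℕ} (M : Matrix (Fin n) (Fin n) ℝ) : Prop :=
  spectralRadius ℂ (M.map (algebraMap ℝ ℂ)) < 1

/-- The pair `(A, B)` is stabilizable: some state feedback `K` makes `A + B K` stable. -/
def IsStabilizable {n p : ℕ} (A : Matrix (Fin n) (Fin n) ℝ) (B : Matrix (Fin n) (Fin p) ℝ) :
    Prop :=
  ∃ K : Matrix (Fin p) (Fin n) ℝ, IsStable (A + B * K)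

/-- The pair `(A, C)` is detectable: some output injection `L` makes `A + L C` stable. -/
def IsDetectable {n m : ℕ} (A : Matrix (Fin n) (Fin n) ℝ) (C : Matrix (Fin m) (Fin n) ℝ) :
    Prop :=
  ∃ L : Matrix (Fin n) (Fin m) ℝ, IsStable (A + L * C)

/-- The process noise `w` and the measurement noise `v` are jointly i.i.d. Gaussian over time, with
means `wbar` and `0`, and with joint covariance `diag (W, S)`. The Gaussian laws at different times
coincide because they have the same mean and covariance. -/
structure IsGaussianNoise {Ω : Type*} [MeasurableSpace Ω] (P : MeasureTheory.Measure Ω)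
    {n m : ℕ} (w : ℤ → Ω → (Fin n → ℝ)) (v : ℤ → Ω → (Fin m → ℝ)) (wbar : Fin n → ℝ)
    (W : Matrix (Fin n) (Fin n) ℝ) (S : Matrix (Fin m) (Fin m) ℝ) : Prop where
  indep : ProbabilityTheory.iIndepFun (fun k ω => (w k ω, v k ω)) P
  gaussian : ∀ k, ProbabilityTheory.HasGaussianLaw (fun ω => (w k ω, v k ω)) P
  mean_w : ∀ k i, ∫ ω, w k ω i ∂P = wbar i
  mean_v : ∀ k i, ∫ ω, v k ω i ∂P = 0
  cov_w : ∀ k i j, ProbabilityTheory.covariance (fun ω => w k ω i) (fun ω => w k ω j) P = W i j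
  cov_v : ∀ k i j, ProbabilityTheory.covariance (fun ω => v k ω i) (fun ω => v k ω j) P = S i j
  cov_wv : ∀ k i j, ProbabilityTheory.covariance (fun ω => w k ω i) (fun ω => v k ω j) P = 0

noncomputable section

/-! ### Forward recursion (Kalman filter) -/

/-- One step of the filter Riccati recursion. -/
def filterStep {n m : ℕ} (A : Matrix (Fin n) (Fin n) ℝ) (C : Matrix (Fin m) (Fin n) ℝ)
    (W : Matrix (Fin n) (Fin n) ℝ) (S : Matrix (Fin m) (Fin m) ℝ)
    (X : Matrix (Fin n) (Fin n) ℝ) : Matrix (Fin n) (Fin n) ℝ :=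
  A * X * Aᵀ + W - A * X * Cᵀ * (C * X * Cᵀ + S)⁻¹ * C * X * Aᵀ

/-- The covariance `k` steps after the initial time, where it is zero. -/
def filterCovAux {n m : ℕ} (A : Matrix (Fin n) (Fin n) ℝ) (C : Matrix (Fin m) (Fin n) ℝ)
    (W : Matrix (Fin n) (Fin n) ℝ) (S : Matrix (Fin m) (Fin m) ℝ) :
    ℕ → Matrix (Fin n) (Fin n) ℝ
  | 0 => 0
  | k + 1 => filterStep A C W S (filterCovAux A C W S k)

/-- The covariance `W_t`, for `t ≥ t₀`, of the filter started at time `t₀` with `W_{t₀} = 0`. -/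
def filterCov {n m : ℕ} (A : Matrix (Fin n) (Fin n) ℝ) (C : Matrix (Fin m) (Fin n) ℝ)
    (W : Matrix (Fin n) (Fin n) ℝ) (S : Matrix (Fin m) (Fin m) ℝ) (t₀ t : ℤ) :
    Matrix (Fin n) (Fin n) ℝ :=
  filterCovAux A C W S (t - t₀).toNat

/-- The inflated state penalty `Q + 4 μ Q X Q` for the covariance `X`. -/
def inflated {n : ℕ} (Q : Matrix (Fin n) (Fin n) ℝ) (μ : ℝ) (X : Matrix (Fin n) (Fin n) ℝ) :
    Matrix (Fin n) (Fin n) ℝ :=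
  Q + (4 * μ) • (Q * X * Q)

/-! ### Backward recursions (control) -/

/-- The control gain `-(B'VB + R)⁻¹ B'VA`. -/
def gain {n p : ℕ} (A : Matrix (Fin n) (Fin n) ℝ) (B : Matrix (Fin n) (Fin p) ℝ)
    (R : Matrix (Fin p) (Fin p) ℝ) (V : Matrix (Fin n) (Fin n) ℝ) : Matrix (Fin p) (Fin n) ℝ :=
  -((Bᵀ * V * B + R)⁻¹ * Bᵀ * V * A)

/-- The closed-loop matrix `A + B K` for the gain `K` belonging to `V`. -/
def closedLoop {n p : ℕ} (A : Matrix (Fin n) (Fin n) ℝ) (B : Matrix (Fin n) (Fin p) ℝ)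
    (R : Matrix (Fin p) (Fin p) ℝ) (V : Matrix (Fin n) (Fin n) ℝ) : Matrix (Fin n) (Fin n) ℝ :=
  A + B * gain A B R V

/-- The map `V ↦ (A + BK)'V(A + BK) + K'RK`, with `K` the gain belonging to `V`. -/
def costStep {n p : ℕ} (A : Matrix (Fin n) (Fin n) ℝ) (B : Matrix (Fin n) (Fin p) ℝ)
    (R : Matrix (Fin p) (Fin p) ℝ) (V : Matrix (Fin n) (Fin n) ℝ) : Matrix (Fin n) (Fin n) ℝ :=
  (closedLoop A B R V)ᵀ * V * closedLoop A B R V + (gain A B R V)ᵀ * R * gain A B R V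

/-- The matrix `V_t` at `t = N - 1 - j`, for the state penalties `q t`. -/
def costMatAux {n p : ℕ} (A : Matrix (Fin n) (Fin n) ℝ) (B : Matrix (Fin n) (Fin p) ℝ)
    (R : Matrix (Fin p) (Fin p) ℝ) (q : ℤ → Matrix (Fin n) (Fin n) ℝ) (N : ℤ) :
    ℕ → Matrix (Fin n) (Fin n) ℝ
  | 0 => q (N - 1)
  | j + 1 => costStep A B R (costMatAux A B R q N j) + q (N - 1 - ((j + 1 : ℕ) : ℤ))

/-- The matrix `V_t`, for `t ≤ N - 1`, with state penalties `q t`: `V_{N-1} = q (N-1)` and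
`V_{t-1} = (A + B K_t)' V_t (A + B K_t) + K_t' R K_t + q (t-1)`. -/
def costMat {n p : ℕ} (A : Matrix (Fin n) (Fin n) ℝ) (B : Matrix (Fin n) (Fin p) ℝ)
    (R : Matrix (Fin p) (Fin p) ℝ) (q : ℤ → Matrix (Fin n) (Fin n) ℝ) (N t : ℤ) :
    Matrix (Fin n) (Fin n) ℝ :=
  costMatAux A B R q N (N - 1 - t).toNat

/-- The vector `ξ_t` at `t = N - 1 - j`, for the matrices `V t`. -/
def costVecAux {n p : ℕ} (A : Matrix (Fin n) (Fin n) ℝ) (B : Matrix (Fin n) (Fin p) ℝ)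
    (R : Matrix (Fin p) (Fin p) ℝ) (wbar : Fin n → ℝ) (V : ℤ → Matrix (Fin n) (Fin n) ℝ) (N : ℤ) :
    ℕ → (Fin n → ℝ)
  | 0 => 0
  | j + 1 => (closedLoop A B R (V (N - 1 - (j : ℤ))))ᵀ *ᵥ
      (costVecAux A B R wbar V N j + V (N - 1 - (j : ℤ)) *ᵥ wbar)

/-- The vector `ξ_t`, for `t ≤ N - 1`, for the matrices `V t`: `ξ_{N-1} = 0` and
`ξ_{t-1} = (A + B K_t)' (ξ_t + V_t wbar)`. -/
def costVec {n p : ℕ} (A : Matrix (Fin n) (Fin n) ℝ) (B : Matrix (Fin n) (Fin p) ℝ)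
    (R : Matrix (Fin p) (Fin p) ℝ) (wbar : Fin n → ℝ) (V : ℤ → Matrix (Fin n) (Fin n) ℝ)
    (N t : ℤ) : Fin n → ℝ :=
  costVecAux A B R wbar V N (N - 1 - t).toNat

/-- The affine control term `-(B'VB + R)⁻¹ B' z`. -/
def affineTerm {n p : ℕ} (B : Matrix (Fin n) (Fin p) ℝ) (R : Matrix (Fin p) (Fin p) ℝ)
    (V : Matrix (Fin n) (Fin n) ℝ) (z : Fin n → ℝ) : Fin p → ℝ :=
  -(((Bᵀ * V * B + R)⁻¹ * Bᵀ) *ᵥ z)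

/-- The stationary vector `ξ = (I - (A + BK)')⁻¹ (A + BK)' V wbar`. -/
def costVecLim {n p : ℕ} (A : Matrix (Fin n) (Fin n) ℝ) (B : Matrix (Fin n) (Fin p) ℝ)
    (R : Matrix (Fin p) (Fin p) ℝ) (wbar : Fin n → ℝ) (V : Matrix (Fin n) (Fin n) ℝ) :
    Fin n → ℝ :=
  ((1 - (closedLoop A B R V)ᵀ)⁻¹ * (closedLoop A B R V)ᵀ * V) *ᵥ wbar

/-- The Euclidean norm of a coordinate vector. -/
def eucNorm {n : ℕ} (z : Fin n → ℝ) : ℝ := ‖WithLp.toLp 2 z‖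

end

/-! ### Stabilizing solutions of the algebraic Riccati equations -/

/-- `V` is a stabilizing solution of the control Riccati equation with state penalty `Q`: a
symmetric solution for which the inverse is a genuine one and the closed-loop matrix is stable. -/
structure IsStabilizingControl {n p : ℕ} (A : Matrix (Fin n) (Fin n) ℝ)
    (B : Matrix (Fin n) (Fin p) ℝ) (Q : Matrix (Fin n) (Fin n) ℝ) (R : Matrix (Fin p) (Fin p) ℝ)
    (V : Matrix (Fin n) (Fin n) ℝ) : Prop where
  symm : V.IsSymm
  isUnit : IsUnit (Bᵀ * V * B + R)
  dare : V = Aᵀ * V * A + Q - Aᵀ * V * B * (Bᵀ * V * B + R)⁻¹ * Bᵀ * V * A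
  stable : IsStable (closedLoop A B R V)

/-- `X` is a stabilizing solution of the filter Riccati equation: a symmetric solution for which the
inverse is a genuine one and the error matrix `A - A X C' (C X C' + S)⁻¹ C` is stable. -/
structure IsStabilizingFilter {n m : ℕ} (A : Matrix (Fin n) (Fin n) ℝ)
    (C : Matrix (Fin m) (Fin n) ℝ) (W : Matrix (Fin n) (Fin n) ℝ) (S : Matrix (Fin m) (Fin m) ℝ)
    (X : Matrix (Fin n) (Fin n) ℝ) : Prop where
  symm : X.IsSymm
  isUnit : IsUnit (C * X * Cᵀ + S)
  dare : X = A * X * Aᵀ + W - A * X * Cᵀ * (C * X * Cᵀ + S)⁻¹ * C * X * Aᵀ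
  stable : IsStable (A - A * X * Cᵀ * (C * X * Cᵀ + S)⁻¹ * C)

/-! ### The recursions in integer time -/

theorem filterCov_self {n m : ℕ} (A : Matrix (Fin n) (Fin n) ℝ) (C : Matrix (Fin m) (Fin n) ℝ)
    (W : Matrix (Fin n) (Fin n) ℝ) (S : Matrix (Fin m) (Fin m) ℝ) (t₀ : ℤ) :
    filterCov A C W S t₀ t₀ = 0 := by
  simp [filterCov, filterCovAux]

theorem filterCov_succ {n m : ℕ} (A : Matrix (Fin n) (Fin n) ℝ) (C : Matrix (Fin m) (Fin n) ℝ)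
    (W : Matrix (Fin n) (Fin n) ℝ) (S : Matrix (Fin m) (Fin m) ℝ) (t₀ t : ℤ) (h : t₀ ≤ t) :
    filterCov A C W S t₀ (t + 1) = filterStep A C W S (filterCov A C W S t₀ t) := by
  have e : (t + 1 - t₀).toNat = (t - t₀).toNat + 1 := by omega
  simp [filterCov, e, filterCovAux]

theorem costMat_last {n p : ℕ} (A : Matrix (Fin n) (Fin n) ℝ) (B : Matrix (Fin n) (Fin p) ℝ)
    (R : Matrix (Fin p) (Fin p) ℝ) (q : ℤ → Matrix (Fin n) (Fin n) ℝ) (N : ℤ) :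
    costMat A B R q N (N - 1) = q (N - 1) := by
  simp [costMat, costMatAux]

theorem costMat_pred {n p : ℕ} (A : Matrix (Fin n) (Fin n) ℝ) (B : Matrix (Fin n) (Fin p) ℝ)
    (R : Matrix (Fin p) (Fin p) ℝ) (q : ℤ → Matrix (Fin n) (Fin n) ℝ) (N t : ℤ) (h : t ≤ N - 1) :
    costMat A B R q N (t - 1) = costStep A B R (costMat A B R q N t) + q (t - 1) := by
  have e : (N - 1 - (t - 1)).toNat = (N - 1 - t).toNat + 1 := by omega
  have e2 : N - 1 - (((N - 1 - t).toNat + 1 : ℕ) : ℤ) = t - 1 := by omega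
  rw [costMat, e, costMatAux, e2, costMat]

theorem costVec_last {n p : ℕ} (A : Matrix (Fin n) (Fin n) ℝ) (B : Matrix (Fin n) (Fin p) ℝ)
    (R : Matrix (Fin p) (Fin p) ℝ) (wbar : Fin n → ℝ) (V : ℤ → Matrix (Fin n) (Fin n) ℝ)
    (N : ℤ) : costVec A B R wbar V N (N - 1) = 0 := by
  simp [costVec, costVecAux]

theorem costVec_pred {n p : ℕ} (A : Matrix (Fin n) (Fin n) ℝ) (B : Matrix (Fin n) (Fin p) ℝ)
    (R : Matrix (Fin p) (Fin p) ℝ) (wbar : Fin n → ℝ) (V : ℤ → Matrix (Fin n) (Fin n) ℝ)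
    (N t : ℤ) (h : t ≤ N - 1) :
    costVec A B R wbar V N (t - 1) =
      (closedLoop A B R (V t))ᵀ *ᵥ (costVec A B R wbar V N t + V t *ᵥ wbar) := by
  have e : (N - 1 - (t - 1)).toNat = (N - 1 - t).toNat + 1 := by omega
  have e2 : N - 1 - (((N - 1 - t).toNat : ℕ) : ℤ) = t := by omega
  rw [costVec, e, costVecAux, e2, costVec]

end RiskLQG

namespace RiskLQG

/-! ### Loewner order and spectral norm of real matrices -/

/-! Write Φ(X) = `costStep A B R X` and F_X = A + B K_X for the closed loop of X. Everything rests
on the exact identity Φ(X) − Φ(Y) = F_X'(X − Y)F_Y (`costStep_sub`). Iterating it, the difference of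
two Riccati sequences is the initial difference plus the penalty differences, each multiplied by a
product of closed loops of the first sequence on the left and of the second on the right
(`riccati_sub_eq`). What remains is exponential decay of such products, uniformly over all sequences
with bounded penalties.

That decay is `exists_transition_le`. Stabilizability bounds the sequence by the cost of one fixed
stabilizing gain. Detectability supplies a Lyapunov matrix P for some A + LC, and X_k + εP is then a
time-varying Lyapunov function: F'X_kF falls short of X_{k+1} by K'RK + q_k, which pays for
replacing A + LC by A + BK.

It follows that the iterates from zero are Cauchy with a stabilizing limit, and that they approach
it geometrically. Two stabilizing solutions coincide because their difference is multiplied by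
powers of two stable matrices. The filter is the same problem for (A', C') with data W and S.

For the backward recursion, V_t is compared with the constant sequence V. The initial error keeps
the factor Ā^(N-1-t) on its right. The penalty errors sum geometrically, each at most a constant
times ‖W_t − W∞‖, because the filter contracts from time t onwards. The vectors ξ_t obey a perturbed
linear recursion with the same transition matrices, and the gain and the affine terms depend on the
data in a Lipschitz way. -/

theorem conj_mono {n p : ℕ} {M N : Matrix (Fin n) (Fin n) ℝ} (h : M ≤ N)
    (K : Matrix (Fin n) (Fin p) ℝ) : Kᵀ * M * K ≤ Kᵀ * N * K := by
  rw [Matrix.le_iff] at h ⊢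
  have := h.conjTranspose_mul_mul_same K
  rwa [Matrix.conjTranspose_eq_transpose_of_trivial, Matrix.mul_sub, Matrix.sub_mul] at this

theorem conj_nonneg {n p : ℕ} {M : Matrix (Fin n) (Fin n) ℝ} (h : 0 ≤ M)
    (K : Matrix (Fin n) (Fin p) ℝ) : 0 ≤ Kᵀ * M * K := by
  simpa using conj_mono h K

theorem transpose_mul_self_nonneg {n p : ℕ} (K : Matrix (Fin n) (Fin p) ℝ) : 0 ≤ Kᵀ * K := by
  have := Matrix.posSemidef_conjTranspose_mul_self K
  rwa [Matrix.conjTranspose_eq_transpose_of_trivial, ← Matrix.nonneg_iff_posSemidef] at this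

theorem isSymm_of_nonneg {n : ℕ} {M : Matrix (Fin n) (Fin n) ℝ} (h : 0 ≤ M) : Mᵀ = M := by
  have := (Matrix.nonneg_iff_posSemidef.1 h).isHermitian
  rwa [Matrix.IsHermitian, Matrix.conjTranspose_eq_transpose_of_trivial] at this

theorem norm_transpose {n p : ℕ} (K : Matrix (Fin n) (Fin p) ℝ) : ‖Kᵀ‖ = ‖K‖ := by
  rw [← Matrix.conjTranspose_eq_transpose_of_trivial, Matrix.l2_opNorm_conjTranspose]

theorem eucNorm_sq {n : ℕ} (x : Fin n → ℝ) : eucNorm x ^ 2 = x ⬝ᵥ x := by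
  rw [eucNorm, EuclideanSpace.real_norm_sq_eq]
  simp [dotProduct, sq]

theorem eucNorm_nonneg {n : ℕ} (x : Fin n → ℝ) : 0 ≤ eucNorm x := norm_nonneg _

theorem eucNorm_add_le {n : ℕ} (x y : Fin n → ℝ) : eucNorm (x + y) ≤ eucNorm x + eucNorm y := by
  simpa [eucNorm] using norm_add_le (WithLp.toLp 2 x) (WithLp.toLp 2 y)

theorem eucNorm_neg {n : ℕ} (x : Fin n → ℝ) : eucNorm (-x) = eucNorm x := by
  simp [eucNorm]

theorem eucNorm_mulVec_le {n p : ℕ} (K : Matrix (Fin n) (Fin p) ℝ) (x : Fin p → ℝ) :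
    eucNorm (K *ᵥ x) ≤ ‖K‖ * eucNorm x := by
  simpa [eucNorm] using Matrix.l2_opNorm_mulVec K (WithLp.toLp 2 x)

theorem norm_le_of_eucNorm_mulVec_le {n p : ℕ} (K : Matrix (Fin n) (Fin p) ℝ) {c : ℝ} (hc : 0 ≤ c)
    (h : ∀ x, eucNorm (K *ᵥ x) ≤ c * eucNorm x) : ‖K‖ ≤ c := by
  rw [Matrix.l2_opNorm_def]
  exact ContinuousLinearMap.opNorm_le_bound _ hc fun x => h x.ofLp

theorem dotProduct_le_eucNorm_mul {n : ℕ} (x y : Fin n → ℝ) :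
    x ⬝ᵥ y ≤ eucNorm x * eucNorm y := by
  have := real_inner_le_norm (WithLp.toLp 2 y) (WithLp.toLp 2 x)
  rw [EuclideanSpace.inner_eq_star_dotProduct] at this
  simpa [eucNorm, mul_comm] using this

theorem le_of_dotProduct_mulVec_le {n : ℕ} {M N : Matrix (Fin n) (Fin n) ℝ} (hM : Mᵀ = M)
    (hN : Nᵀ = N) (h : ∀ x, x ⬝ᵥ M *ᵥ x ≤ x ⬝ᵥ N *ᵥ x) : M ≤ N := by
  rw [Matrix.le_iff, Matrix.posSemidef_iff_dotProduct_mulVec]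
  refine ⟨?_, fun x => ?_⟩
  · rw [Matrix.IsHermitian, Matrix.conjTranspose_eq_transpose_of_trivial, Matrix.transpose_sub,
      hM, hN]
  · simpa [Matrix.sub_mulVec] using h x

theorem dotProduct_mulVec_le_of_le {n : ℕ} {M N : Matrix (Fin n) (Fin n) ℝ} (h : M ≤ N)
    (x : Fin n → ℝ) : x ⬝ᵥ M *ᵥ x ≤ x ⬝ᵥ N *ᵥ x := by
  have := (Matrix.posSemidef_iff_dotProduct_mulVec.1 (Matrix.le_iff.1 h)).2 x
  simpa [Matrix.sub_mulVec] using this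

theorem le_norm_smul_one {n : ℕ} {M : Matrix (Fin n) (Fin n) ℝ} (hM : Mᵀ = M) :
    M ≤ ‖M‖ • (1 : Matrix (Fin n) (Fin n) ℝ) := by
  refine le_of_dotProduct_mulVec_le hM (by simp) fun x => ?_
  have h1 := dotProduct_le_eucNorm_mul x (M *ᵥ x)
  have h2 := eucNorm_mulVec_le M x
  have h3 := eucNorm_sq x
  have h4 := eucNorm_nonneg x
  simp only [Matrix.smul_mulVec, Matrix.one_mulVec, dotProduct_smul, smul_eq_mul, ← h3]
  nlinarith [mul_le_mul_of_nonneg_left h2 h4]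

theorem smul_one_mono {n : ℕ} {a b : ℝ} (h : a ≤ b) :
    a • (1 : Matrix (Fin n) (Fin n) ℝ) ≤ b • (1 : Matrix (Fin n) (Fin n) ℝ) := by
  rw [Matrix.le_iff, ← sub_smul]
  exact Matrix.PosSemidef.one.smul (sub_nonneg.2 h)

theorem smul_mono_right {n : ℕ} {a : ℝ} (ha : 0 ≤ a) {M N : Matrix (Fin n) (Fin n) ℝ}
    (h : M ≤ N) : a • M ≤ a • N := by
  rw [Matrix.le_iff, ← smul_sub]
  exact (Matrix.le_iff.1 h).smul ha

theorem smul_mono_left {n : ℕ} {a b : ℝ} (h : a ≤ b) {M : Matrix (Fin n) (Fin n) ℝ}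
    (hM : 0 ≤ M) : a • M ≤ b • M := by
  rw [Matrix.le_iff, ← sub_smul]
  exact (Matrix.nonneg_iff_posSemidef.1 hM).smul (sub_nonneg.2 h)

theorem zero_le_one_matrix {n : ℕ} : (0 : Matrix (Fin n) (Fin n) ℝ) ≤ 1 :=
  Matrix.nonneg_iff_posSemidef.2 Matrix.PosSemidef.one

theorem transpose_mul_self_le {n p : ℕ} (K : Matrix (Fin n) (Fin p) ℝ) :
    Kᵀ * K ≤ (‖K‖ ^ 2) • (1 : Matrix (Fin p) (Fin p) ℝ) := by
  have := le_norm_smul_one (M := Kᵀ * K) (by simp)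
  rwa [← Matrix.conjTranspose_eq_transpose_of_trivial, Matrix.l2_opNorm_conjTranspose_mul_self,
    ← sq] at this

theorem norm_sq_le_of_transpose_mul_self_le {n p : ℕ} {K : Matrix (Fin n) (Fin p) ℝ} {c : ℝ}
    (hc : 0 ≤ c) (h : Kᵀ * K ≤ c • (1 : Matrix (Fin p) (Fin p) ℝ)) : ‖K‖ ^ 2 ≤ c := by
  rw [← Real.le_sqrt (norm_nonneg _) hc]
  refine norm_le_of_eucNorm_mulVec_le K (Real.sqrt_nonneg c) fun x => ?_
  have h1 := dotProduct_mulVec_le_of_le h x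
  rw [← Matrix.mulVec_mulVec, Matrix.dotProduct_mulVec, Matrix.vecMul_transpose, ← eucNorm_sq,
    Matrix.smul_mulVec, Matrix.one_mulVec, dotProduct_smul, ← eucNorm_sq, smul_eq_mul] at h1
  refine abs_le_of_sq_le_sq' ?_ (by have := eucNorm_nonneg x; positivity) |>.2
  rwa [mul_pow, Real.sq_sqrt hc]

theorem exists_transpose_mul_self {n : ℕ} {M : Matrix (Fin n) (Fin n) ℝ} (h : 0 ≤ M) :
    ∃ s : Matrix (Fin n) (Fin n) ℝ, M = sᵀ * s := by
  refine ⟨CFC.sqrt M, ?_⟩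
  rw [isSymm_of_nonneg (CFC.sqrt_nonneg M), CFC.sqrt_mul_sqrt_self M h]

theorem norm_le_of_nonneg_of_le {n : ℕ} {M : Matrix (Fin n) (Fin n) ℝ} {c : ℝ} (hc : 0 ≤ c)
    (h0 : 0 ≤ M) (h : M ≤ c • (1 : Matrix (Fin n) (Fin n) ℝ)) : ‖M‖ ≤ c := by
  obtain ⟨s, rfl⟩ := exists_transpose_mul_self h0
  have := norm_sq_le_of_transpose_mul_self_le hc h
  rwa [← Matrix.conjTranspose_eq_transpose_of_trivial, Matrix.l2_opNorm_conjTranspose_mul_self,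
    ← sq]

/-- With M = s's and s invertible, conjugating (s⁻¹)'s⁻¹ ≤ ‖s⁻¹‖² by s gives 1 ≤ ‖s⁻¹‖² M. The
constant is enlarged by 1 so that it stays positive in dimension zero. -/
theorem exists_smul_one_le_of_posDef {n : ℕ} {M : Matrix (Fin n) (Fin n) ℝ} (h : M.PosDef) :
    ∃ r : ℝ, 0 < r ∧ r • (1 : Matrix (Fin n) (Fin n) ℝ) ≤ M := by
  obtain ⟨s, hs⟩ := exists_transpose_mul_self (Matrix.nonneg_iff_posSemidef.2 h.posSemidef)
  have hu : IsUnit s := by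
    have := h.isUnit
    rw [hs] at this
    rw [Matrix.isUnit_iff_isUnit_det] at this ⊢
    rw [Matrix.det_mul] at this
    exact isUnit_of_mul_isUnit_right this
  have h1 := conj_mono (transpose_mul_self_le s⁻¹) s
  have h2 : s⁻¹ * s = 1 := Matrix.nonsing_inv_mul s ((Matrix.isUnit_iff_isUnit_det s).1 hu)
  have h3 : sᵀ * ((s⁻¹)ᵀ * s⁻¹) * s = 1 := by
    rw [show sᵀ * ((s⁻¹)ᵀ * s⁻¹) * s = (s⁻¹ * s)ᵀ * (s⁻¹ * s) by
      simp only [Matrix.transpose_mul, Matrix.mul_assoc], h2]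
    simp
  rw [h3, Matrix.mul_smul, Matrix.mul_one, Matrix.smul_mul, ← hs] at h1
  have hc : 0 < ‖s⁻¹‖ ^ 2 + 1 := by positivity
  refine ⟨(‖s⁻¹‖ ^ 2 + 1)⁻¹, inv_pos.2 hc, ?_⟩
  have h4 : (1 : Matrix (Fin n) (Fin n) ℝ) ≤ (‖s⁻¹‖ ^ 2 + 1) • M :=
    h1.trans (smul_mono_left (by linarith) (Matrix.nonneg_iff_posSemidef.2 h.posSemidef))
  have h5 := smul_mono_right (inv_pos.2 hc).le h4
  rwa [smul_smul, inv_mul_cancel₀ hc.ne', one_smul] at h5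

theorem isUnit_of_smul_one_le {n : ℕ} {M : Matrix (Fin n) (Fin n) ℝ} {r : ℝ} (hr : 0 < r)
    (h : r • (1 : Matrix (Fin n) (Fin n) ℝ) ≤ M) : IsUnit M := by
  have h1 : (r • (1 : Matrix (Fin n) (Fin n) ℝ)).PosDef := Matrix.PosDef.one.smul hr
  have h2 := h1.add_posSemidef (Matrix.le_iff.1 h)
  rw [add_sub_cancel] at h2
  exact h2.isUnit

/-- For y = M⁻¹x the lower bound gives r|y|² ≤ y·My = y·x ≤ |y||x|. Applied to B'XB + R, it bounds
the inverse uniformly over all X ≥ 0. -/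
theorem norm_inv_le {n : ℕ} {M : Matrix (Fin n) (Fin n) ℝ} {r : ℝ} (hr : 0 < r)
    (h : r • (1 : Matrix (Fin n) (Fin n) ℝ) ≤ M) : ‖M⁻¹‖ ≤ r⁻¹ := by
  have hu := (Matrix.isUnit_iff_isUnit_det M).1 (isUnit_of_smul_one_le hr h)
  refine norm_le_of_eucNorm_mulVec_le _ (inv_pos.2 hr).le fun x => ?_
  have h1 := dotProduct_mulVec_le_of_le h (M⁻¹ *ᵥ x)
  rw [Matrix.mulVec_mulVec x M, Matrix.mul_nonsing_inv M hu, Matrix.one_mulVec, Matrix.smul_mulVec,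
    Matrix.one_mulVec, dotProduct_smul, ← eucNorm_sq, smul_eq_mul] at h1
  have h2 := h1.trans (dotProduct_le_eucNorm_mul _ x)
  rw [inv_mul_eq_div, le_div_iff₀ hr]
  have h3 := eucNorm_nonneg (M⁻¹ *ᵥ x)
  rcases h3.eq_or_lt with h0 | h0
  · rw [← h0, zero_mul]; exact eucNorm_nonneg x
  · refine le_of_mul_le_mul_left ?_ h0
    linarith

theorem isClosed_nonneg {n : ℕ} : IsClosed {M : Matrix (Fin n) (Fin n) ℝ | 0 ≤ M} := by
  have : {M : Matrix (Fin n) (Fin n) ℝ | 0 ≤ M} =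
      {M | Mᵀ = M} ∩ ⋂ x : Fin n → ℝ, {M | 0 ≤ x ⬝ᵥ M *ᵥ x} := by
    ext M
    simp only [Set.mem_ofPred_eq, Set.mem_inter_iff, Set.mem_iInter]
    constructor
    · exact fun h => ⟨isSymm_of_nonneg h, fun x => by simpa using dotProduct_mulVec_le_of_le h x⟩
    · exact fun h => le_of_dotProduct_mulVec_le (by simp) h.1 fun x => by simpa using h.2 x
  rw [this]
  refine (isClosed_eq (by fun_prop) continuous_id).inter (isClosed_iInter fun x => ?_)
  refine isClosed_le continuous_const ?_
  fun_prop

/-! ### Schur stability -/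

theorem map_complex_pow {n : ℕ} (M : Matrix (Fin n) (Fin n) ℝ) (k : ℕ) :
    (M ^ k).map (algebraMap ℝ ℂ) = (M.map (algebraMap ℝ ℂ)) ^ k :=
  map_pow (algebraMap ℝ ℂ).mapMatrix M k

/-- Passing to complex matrices changes norms by bounded factors only. -/
theorem exists_norm_map_complex_equiv (n : ℕ) : ∃ a : ℝ, 0 < a ∧
    ∀ M : Matrix (Fin n) (Fin n) ℝ, ‖M‖ ≤ a * ‖M.map (algebraMap ℝ ℂ)‖ ∧
      ‖M.map (algebraMap ℝ ℂ)‖ ≤ a * ‖M‖ := by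
  let f : Matrix (Fin n) (Fin n) ℝ →ₗ[ℝ] Matrix (Fin n) (Fin n) ℂ :=
    (Algebra.linearMap ℝ ℂ).mapMatrix
  have hf : ∀ M, f M = M.map (algebraMap ℝ ℂ) := fun M => rfl
  have hinj : LinearMap.ker f = ⊥ := by
    refine LinearMap.ker_eq_bot.2 fun M N h => ?_
    ext i j
    have := congr_fun (congr_fun h i) j
    simpa [hf] using this
  obtain ⟨K, hK, hanti⟩ := f.exists_antilipschitzWith hinj
  let g := LinearMap.toContinuousLinearMap f
  refine ⟨max (K : ℝ) (‖g‖ + 1), lt_max_of_lt_left (by exact_mod_cast hK), fun M => ⟨?_, ?_⟩⟩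
  · have := hanti.le_mul_dist M 0
    simp only [dist_zero_right, map_zero] at this
    exact this.trans (mul_le_mul_of_nonneg_right (le_max_left _ _) (norm_nonneg _))
  · refine (g.le_opNorm M).trans (mul_le_mul_of_nonneg_right ?_ (norm_nonneg _))
    exact (by linarith : ‖g‖ ≤ ‖g‖ + 1).trans (le_max_right _ _)

theorem exists_forall_le_mul_pow_of_eventually {f : ℕ → ℝ} {ρ : ℝ} (hρ : 0 < ρ)
    (h : ∀ᶠ k in Filter.atTop, f k ≤ ρ ^ k) : ∃ c : ℝ, 0 < c ∧ ∀ k, f k ≤ c * ρ ^ k := by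
  obtain ⟨N, hN⟩ := Filter.eventually_atTop.1 h
  refine ⟨1 + ∑ i ∈ Finset.range N, |f i| / ρ ^ i, by positivity, fun k => ?_⟩
  have hs : ∀ i ∈ Finset.range N, 0 ≤ |f i| / ρ ^ i := fun i _ => by positivity
  have hp := pow_pos hρ k
  rcases lt_or_ge k N with hk | hk
  · have h1 := Finset.single_le_sum hs (Finset.mem_range.2 hk)
    rw [← div_le_iff₀ hp]
    have h2 : f k / ρ ^ k ≤ |f k| / ρ ^ k := div_le_div_of_nonneg_right (le_abs_self _) hp.le
    linarith
  · have h1 := Finset.sum_nonneg hs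
    have h2 := hN k hk
    nlinarith

/-- Gelfand's formula for the complexified matrix, with a rate strictly between the spectral radius
and 1. -/
theorem IsStable.exists_norm_pow_le {n : ℕ} {M : Matrix (Fin n) (Fin n) ℝ} (h : IsStable M) :
    ∃ c ρ : ℝ, 0 < c ∧ 0 < ρ ∧ ρ < 1 ∧ ∀ k, ‖M ^ k‖ ≤ c * ρ ^ k := by
  obtain ⟨a, ha, hnorm⟩ := exists_norm_map_complex_equiv n
  obtain ⟨ρ, hρ1, hρ2⟩ := ENNReal.lt_iff_exists_nnreal_btwn.1 h
  have hρ0 : 0 < (ρ : ℝ) := by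
    have : (0 : ENNReal) < ρ := (zero_le).trans_lt hρ1
    exact_mod_cast this
  have hlim := spectrum.pow_norm_pow_one_div_tendsto_nhds_spectralRadius
    (M.map (algebraMap ℝ ℂ))
  have hev : ∀ᶠ k in Filter.atTop, ‖(M.map (algebraMap ℝ ℂ)) ^ k‖ ≤ (ρ : ℝ) ^ k := by
    filter_upwards [hlim.eventually_lt_const hρ1, Filter.eventually_gt_atTop 0] with k hk hk0
    have h1 : ‖(M.map (algebraMap ℝ ℂ)) ^ k‖ ^ (1 / k : ℝ) ≤ ρ := by
      rw [← ENNReal.ofReal_coe_nnreal, ENNReal.ofReal_lt_ofReal_iff hρ0] at hk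
      exact hk.le
    have h2 := pow_le_pow_left₀ (by positivity) h1 k
    rwa [one_div, Real.rpow_inv_natCast_pow (norm_nonneg _) hk0.ne'] at h2
  obtain ⟨c, hc, hck⟩ := exists_forall_le_mul_pow_of_eventually hρ0 hev
  refine ⟨a * c, ρ, mul_pos ha hc, hρ0, by exact_mod_cast hρ2, fun k => ?_⟩
  have h1 := (hnorm (M ^ k)).1
  rw [map_complex_pow] at h1
  rw [mul_assoc]
  exact h1.trans (mul_le_mul_of_nonneg_left (hck k) ha.le)

/-- One positive power of the complexification has norm below 1, and the corresponding power of the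
spectral radius is at most that norm. -/
theorem isStable_of_norm_pow_le {n : ℕ} {M : Matrix (Fin n) (Fin n) ℝ} {c ρ : ℝ} (hρ0 : 0 ≤ ρ)
    (hρ1 : ρ < 1) (h : ∀ k, ‖M ^ k‖ ≤ c * ρ ^ k) : IsStable M := by
  obtain ⟨a, ha, hnorm⟩ := exists_norm_map_complex_equiv n
  rcases n.eq_zero_or_pos with rfl | hn
  · rw [IsStable, spectrum.SpectralRadius.of_subsingleton]
    exact zero_lt_one
  have : Nonempty (Fin n) := ⟨⟨0, hn⟩⟩
  have hlim : Filter.Tendsto (fun k : ℕ => a * (c * ρ ^ k)) Filter.atTop (nhds 0) := by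
    simpa using ((tendsto_pow_atTop_nhds_zero_of_lt_one hρ0 hρ1).const_mul c).const_mul a
  obtain ⟨k, hk, hk0⟩ := ((hlim.eventually_lt_const zero_lt_one).and
    (Filter.eventually_gt_atTop 0)).exists
  have h1 : ‖(M.map (algebraMap ℝ ℂ)) ^ k‖ < 1 := by
    rw [← map_complex_pow]
    exact ((hnorm _).2.trans (mul_le_mul_of_nonneg_left (h k) ha.le)).trans_lt hk
  have h2 := (spectrum.spectralRadius_pow_le (𝕜 := ℂ) (M.map (algebraMap ℝ ℂ)) k hk0.ne').trans
    (spectrum.spectralRadius_le_nnnorm _)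
  have h3 : (‖(M.map (algebraMap ℝ ℂ)) ^ k‖₊ : ENNReal) < 1 := by exact_mod_cast h1
  rw [IsStable]
  by_contra hge
  exact absurd (h2.trans_lt h3) (not_lt.2 (one_le_pow₀ (not_lt.1 hge)))

theorem IsStable.transpose {n : ℕ} {M : Matrix (Fin n) (Fin n) ℝ} (h : IsStable M) :
    IsStable Mᵀ := by
  obtain ⟨c, ρ, -, hρ0, hρ1, hM⟩ := h.exists_norm_pow_le
  refine isStable_of_norm_pow_le hρ0.le hρ1 (c := c) fun k => ?_
  rw [← Matrix.transpose_pow, norm_transpose]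
  exact hM k

theorem IsStable.isUnit_one_sub {n : ℕ} {M : Matrix (Fin n) (Fin n) ℝ} (h : IsStable M) :
    IsUnit (1 - M) := by
  obtain ⟨c, ρ, -, hρ0, hρ1, hM⟩ := h.exists_norm_pow_le
  have hs : Summable fun k => ‖M ^ k‖ :=
    Summable.of_nonneg_of_le (fun _ => norm_nonneg _) hM
      ((summable_geometric_of_lt_one hρ0.le hρ1).mul_left c)
  exact .of_mul_eq_one_right _ hs.of_norm.tsum_pow_mul_one_sub

/-- A discrete Lyapunov inequality for a stable matrix. -/
theorem IsStable.exists_lyapunov {n : ℕ} {G : Matrix (Fin n) (Fin n) ℝ} (h : IsStable G) :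
    ∃ P : Matrix (Fin n) (Fin n) ℝ, 1 ≤ P ∧
      Gᵀ * P * G ≤ P - (1 / 2 : ℝ) • (1 : Matrix (Fin n) (Fin n) ℝ) := by
  obtain ⟨c, ρ, -, hρ0, hρ1, hG⟩ := h.exists_norm_pow_le
  have hlim : Filter.Tendsto (fun k : ℕ => (c * ρ ^ k) ^ 2) Filter.atTop (nhds 0) := by
    simpa using ((tendsto_pow_atTop_nhds_zero_of_lt_one hρ0.le hρ1).const_mul c).pow 2
  obtain ⟨k, hk⟩ := ((Filter.tendsto_add_atTop_iff_nat 1).2 hlim |>.eventually_lt_const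
    (show (0 : ℝ) < 1 / 2 by norm_num)).exists
  have hnn : ∀ i, 0 ≤ (G ^ i)ᵀ * G ^ i := fun i => transpose_mul_self_nonneg _
  -- The Lyapunov series is cut off where the next term is at most 1/2. Conjugation by G shifts the
  -- sum: it loses the term 1 at i = 0 and gains at most 1/2.
  refine ⟨∑ i ∈ Finset.range (k + 1), (G ^ i)ᵀ * G ^ i, ?_, ?_⟩
  · simpa using Finset.single_le_sum (fun i _ => hnn i) (Finset.mem_range.2 k.succ_pos)
  · have h1 : Gᵀ * (∑ i ∈ Finset.range (k + 1), (G ^ i)ᵀ * G ^ i) * G =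
        ∑ i ∈ Finset.range (k + 1), (G ^ (i + 1))ᵀ * G ^ (i + 1) := by
      rw [Finset.mul_sum, Finset.sum_mul]
      refine Finset.sum_congr rfl fun i _ => ?_
      simp only [pow_succ, Matrix.transpose_mul, Matrix.mul_assoc]
    have h2 : ∑ i ∈ Finset.range (k + 1), (G ^ (i + 1))ᵀ * G ^ (i + 1) =
        ∑ i ∈ Finset.range (k + 1), (G ^ i)ᵀ * G ^ i - 1 + (G ^ (k + 1))ᵀ * G ^ (k + 1) := by
      have := Finset.sum_range_succ' (fun i => (G ^ i)ᵀ * G ^ i) (k + 1)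
      rw [Finset.sum_range_succ] at this
      rw [sub_add_eq_add_sub, this]
      simp
    have h3 : (G ^ (k + 1))ᵀ * G ^ (k + 1) ≤ (1 / 2 : ℝ) • (1 : Matrix (Fin n) (Fin n) ℝ) := by
      refine (transpose_mul_self_le _).trans (smul_one_mono (le_trans ?_ hk.le))
      exact pow_le_pow_left₀ (norm_nonneg _) (hG _) 2
    rw [h1, h2, show ∑ i ∈ Finset.range (k + 1), (G ^ i)ᵀ * G ^ i -
      (1 / 2 : ℝ) • (1 : Matrix (Fin n) (Fin n) ℝ) = ∑ i ∈ Finset.range (k + 1), (G ^ i)ᵀ * G ^ i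
      - 1 + (1 / 2 : ℝ) • (1 : Matrix (Fin n) (Fin n) ℝ) by module]
    exact add_le_add_right h3 _

/-! ### Algebra of the Riccati map -/

section Algebra

variable {n p : ℕ} {A : Matrix (Fin n) (Fin n) ℝ} {B : Matrix (Fin n) (Fin p) ℝ}
  {R : Matrix (Fin p) (Fin p) ℝ} {X Y : Matrix (Fin n) (Fin n) ℝ}

theorem mul_gain (hX : IsUnit (Bᵀ * X * B + R)) :
    (Bᵀ * X * B + R) * gain A B R X = -(Bᵀ * X * A) := by
  rw [gain, Matrix.mul_neg]
  simp only [← Matrix.mul_assoc]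
  rw [Matrix.mul_nonsing_inv _ ((Matrix.isUnit_iff_isUnit_det _).1 hX), Matrix.one_mul]

/-- The first-order optimality condition of the gain. It is what makes the cross terms cancel in the
identities below. -/
theorem transpose_mul_mul_closedLoop (hX : IsUnit (Bᵀ * X * B + R)) :
    Bᵀ * X * closedLoop A B R X = -(R * gain A B R X) := by
  have h := mul_gain (A := A) hX
  rw [Matrix.add_mul] at h
  rw [closedLoop, Matrix.mul_add, ← Matrix.mul_assoc, ← neg_eq_iff_eq_neg.2 h]
  abel

theorem closedLoop_transpose_mul_mul (hX : IsUnit (Bᵀ * X * B + R)) (hXs : Xᵀ = X)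
    (hR : Rᵀ = R) : (closedLoop A B R X)ᵀ * X * B = -((gain A B R X)ᵀ * R) := by
  have := congr_arg Matrix.transpose (transpose_mul_mul_closedLoop (A := A) hX)
  simpa [Matrix.transpose_mul, hXs, hR, Matrix.mul_assoc] using this

theorem costStep_eq (hX : IsUnit (Bᵀ * X * B + R)) :
    costStep A B R X = Aᵀ * X * closedLoop A B R X := by
  have h := transpose_mul_mul_closedLoop (A := A) hX
  rw [costStep]
  nth_rw 1 [closedLoop]
  rw [Matrix.transpose_add, Matrix.transpose_mul, Matrix.add_mul, Matrix.add_mul,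
    Matrix.mul_assoc _ Bᵀ X, Matrix.mul_assoc _ (Bᵀ * X), h]
  simp [Matrix.mul_assoc]

theorem costStep_transpose (hXs : Xᵀ = X) (hR : Rᵀ = R) :
    (costStep A B R X)ᵀ = costStep A B R X := by
  simp [costStep, Matrix.transpose_mul, hXs, hR, Matrix.mul_assoc]

/-- By optimality of both gains, F_X'XF_Y and F_X'YF_Y differ from Φ(X) and Φ(Y) by the same term
K_X'RK_Y. The identity is exact, with no quadratic remainder, because the two closed loops are
different. -/
theorem costStep_sub (hX : IsUnit (Bᵀ * X * B + R)) (hY : IsUnit (Bᵀ * Y * B + R))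
    (hXs : Xᵀ = X) (hR : Rᵀ = R) :
    costStep A B R X - costStep A B R Y =
      (closedLoop A B R X)ᵀ * (X - Y) * closedLoop A B R Y := by
  have h1 : costStep A B R X = (closedLoop A B R X)ᵀ * X * A := by
    rw [← costStep_transpose hXs hR, costStep_eq hX]
    simp [Matrix.transpose_mul, hXs, Matrix.mul_assoc]
  have h2 : (closedLoop A B R X)ᵀ * X * closedLoop A B R Y =
      (closedLoop A B R X)ᵀ * X * A - (gain A B R X)ᵀ * R * gain A B R Y := by
    nth_rw 2 [closedLoop]
    rw [Matrix.mul_add, ← Matrix.mul_assoc, closedLoop_transpose_mul_mul hX hXs hR,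
      Matrix.neg_mul, sub_eq_add_neg]
  have h3 : (closedLoop A B R X)ᵀ * Y * closedLoop A B R Y =
      Aᵀ * Y * closedLoop A B R Y - (gain A B R X)ᵀ * R * gain A B R Y := by
    nth_rw 1 [closedLoop]
    rw [Matrix.transpose_add, Matrix.transpose_mul, Matrix.add_mul, Matrix.add_mul,
      Matrix.mul_assoc _ Bᵀ Y, Matrix.mul_assoc _ (Bᵀ * Y), transpose_mul_mul_closedLoop hY,
      Matrix.mul_neg, sub_eq_add_neg, Matrix.mul_assoc _ R]
  rw [Matrix.mul_sub, Matrix.sub_mul, h2, h3, h1, costStep_eq hY]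
  abel

/-- Completion of the square in the gain. For X ≥ 0 the last term is nonnegative, so `gain`
minimizes the one-step cost; this is `costStep_le`. -/
theorem cost_eq_costStep_add (hX : IsUnit (Bᵀ * X * B + R)) (hXs : Xᵀ = X) (hR : Rᵀ = R)
    (K : Matrix (Fin p) (Fin n) ℝ) :
    (A + B * K)ᵀ * X * (A + B * K) + Kᵀ * R * K = costStep A B R X +
      (K - gain A B R X)ᵀ * (Bᵀ * X * B + R) * (K - gain A B R X) := by
  have h1 := transpose_mul_mul_closedLoop (A := A) hX
  have h2 := closedLoop_transpose_mul_mul (A := A) hX hXs hR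
  rw [costStep]
  set F := closedLoop A B R X with hF
  set L := gain A B R X with hL
  obtain ⟨D, rfl⟩ : ∃ D, K = L + D := ⟨K - L, by abel⟩
  have h3 : A + B * (L + D) = F + B * D := by
    rw [hF, closedLoop, Matrix.mul_add]; abel
  have h4 : Fᵀ * X * (B * D) = -(Lᵀ * R * D) := by
    rw [← Matrix.mul_assoc, h2, Matrix.neg_mul]
  have h5 : Dᵀ * Bᵀ * X * F = -(Dᵀ * R * L) := by
    rw [Matrix.mul_assoc Dᵀ, Matrix.mul_assoc Dᵀ, h1, Matrix.mul_neg, Matrix.mul_assoc]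
  rw [h3, add_sub_cancel_left]
  simp only [Matrix.transpose_add, Matrix.transpose_mul, Matrix.add_mul, Matrix.mul_add, h4, h5]
  simp only [Matrix.mul_assoc]
  abel

/-- Obtained by subtracting the normal equations of the two gains, so that no difference of inverses
appears. -/
theorem gain_sub_gain (hX : IsUnit (Bᵀ * X * B + R)) (hY : IsUnit (Bᵀ * Y * B + R)) :
    gain A B R X - gain A B R Y =
      -((Bᵀ * X * B + R)⁻¹ * (Bᵀ * (X - Y) * closedLoop A B R Y)) := by
  have h1 := mul_gain (A := A) hX
  have h2 := transpose_mul_mul_closedLoop (A := A) hY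
  have h3 : (Bᵀ * X * B + R) * (gain A B R X - gain A B R Y) =
      -(Bᵀ * (X - Y) * closedLoop A B R Y) := by
    rw [Matrix.mul_sub, h1, Matrix.mul_sub, Matrix.sub_mul, h2, closedLoop]
    simp only [Matrix.mul_add, Matrix.add_mul, Matrix.mul_assoc]
    abel
  rw [← Matrix.mul_neg, ← h3, ← Matrix.mul_assoc,
    Matrix.nonsing_inv_mul _ ((Matrix.isUnit_iff_isUnit_det _).1 hX), Matrix.one_mul]

theorem dare_iff (Q : Matrix (Fin n) (Fin n) ℝ) (hX : IsUnit (Bᵀ * X * B + R)) :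
    X = Aᵀ * X * A + Q - Aᵀ * X * B * (Bᵀ * X * B + R)⁻¹ * Bᵀ * X * A ↔
      costStep A B R X + Q = X := by
  rw [costStep_eq hX, closedLoop, gain, eq_comm]
  simp only [Matrix.mul_add, Matrix.mul_neg, Matrix.mul_assoc]
  rw [sub_eq_add_neg, add_right_comm]

theorem costStep_nonneg (hX : 0 ≤ X) (hR : 0 ≤ R) : 0 ≤ costStep A B R X :=
  add_nonneg (conj_nonneg hX _) (conj_nonneg hR _)

theorem smul_one_le_add {r : ℝ} (hX : 0 ≤ X)
    (hr : r • (1 : Matrix (Fin p) (Fin p) ℝ) ≤ R) :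
    r • (1 : Matrix (Fin p) (Fin p) ℝ) ≤ Bᵀ * X * B + R := by
  simpa using add_le_add (conj_nonneg hX B) hr

theorem isUnit_of_nonneg (hX : 0 ≤ X) (hR : R.PosDef) : IsUnit (Bᵀ * X * B + R) := by
  obtain ⟨r, hr, hrR⟩ := exists_smul_one_le_of_posDef hR
  exact isUnit_of_smul_one_le hr (smul_one_le_add hX hrR)

theorem transpose_eq_of_posDef (hR : R.PosDef) : Rᵀ = R :=
  isSymm_of_nonneg (Matrix.nonneg_iff_posSemidef.2 hR.posSemidef)

theorem costStep_le (hX : 0 ≤ X) (hR : R.PosDef) (K : Matrix (Fin p) (Fin n) ℝ) :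
    costStep A B R X ≤ (A + B * K)ᵀ * X * (A + B * K) + Kᵀ * R * K := by
  rw [cost_eq_costStep_add (isUnit_of_nonneg hX hR) (isSymm_of_nonneg hX)
    (transpose_eq_of_posDef hR)]
  exact le_add_of_nonneg_right (conj_nonneg (add_nonneg (conj_nonneg hX B)
    (Matrix.nonneg_iff_posSemidef.2 hR.posSemidef)) _)

/-- The product `F (X k) * F (X (k + 1)) * ⋯ * F (X (k + j - 1))` of closed-loop matrices. -/
noncomputable def transition (A : Matrix (Fin n) (Fin n) ℝ) (B : Matrix (Fin n) (Fin p) ℝ)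
    (R : Matrix (Fin p) (Fin p) ℝ) (X : ℕ → Matrix (Fin n) (Fin n) ℝ) (k : ℕ) :
    ℕ → Matrix (Fin n) (Fin n) ℝ
  | 0 => 1
  | j + 1 => transition A B R X k j * closedLoop A B R (X (k + j))

theorem transition_const (X : Matrix (Fin n) (Fin n) ℝ) (k j : ℕ) :
    transition A B R (fun _ => X) k j = closedLoop A B R X ^ j := by
  induction j with
  | zero => simp [transition]
  | succ j ih => rw [transition, ih, pow_succ]

/-- The difference of two Riccati sequences in terms of the initial difference and the differences
of the penalties. -/
theorem riccati_sub_eq {X Y q r : ℕ → Matrix (Fin n) (Fin n) ℝ}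
    (hX : ∀ k, IsUnit (Bᵀ * X k * B + R)) (hY : ∀ k, IsUnit (Bᵀ * Y k * B + R))
    (hXs : ∀ k, (X k)ᵀ = X k) (hR : Rᵀ = R)
    (hXq : ∀ k, X (k + 1) = costStep A B R (X k) + q k)
    (hYr : ∀ k, Y (k + 1) = costStep A B R (Y k) + r k) (k j : ℕ) :
    X (k + j) - Y (k + j) =
      (transition A B R X k j)ᵀ * (X k - Y k) * transition A B R Y k j +
      ∑ i ∈ Finset.range j, (transition A B R X (k + i + 1) (j - 1 - i))ᵀ *
        (q (k + i) - r (k + i)) * transition A B R Y (k + i + 1) (j - 1 - i) := by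
  induction j with
  | zero => simp [transition]
  | succ j ih =>
    have h1 : X (k + (j + 1)) - Y (k + (j + 1)) = (closedLoop A B R (X (k + j)))ᵀ *
        (X (k + j) - Y (k + j)) * closedLoop A B R (Y (k + j)) + (q (k + j) - r (k + j)) := by
      rw [← costStep_sub (hX _) (hY _) (hXs _) hR, ← add_assoc, hXq, hYr]
      abel
    rw [h1, ih, Finset.sum_range_succ, Matrix.mul_add, Matrix.add_mul, Finset.mul_sum,
      Finset.sum_mul, add_assoc]
    congr 1
    · simp only [transition, Matrix.transpose_mul, Matrix.mul_assoc]
    congr 1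
    · refine Finset.sum_congr rfl fun i hi => ?_
      have hi := Finset.mem_range.1 hi
      have e1 : j + 1 - 1 - i = (j - 1 - i) + 1 := by omega
      have e2 : k + i + 1 + (j - 1 - i) = k + j := by omega
      simp only [e1, transition, e2, Matrix.transpose_mul, Matrix.mul_assoc]
    · simp [transition]

end Algebra

/-! ### Uniform exponential stability of the closed loop -/

/-- Young's inequality for the form P: the gap between the two sides is δ⁻¹(δH − D)'P(δH − D). -/
theorem conj_add_le {n p : ℕ} {P : Matrix (Fin n) (Fin n) ℝ} (hP : 0 ≤ P) {δ : ℝ} (hδ : 0 < δ)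
    (H D : Matrix (Fin n) (Fin p) ℝ) :
    (H + D)ᵀ * P * (H + D) ≤ (1 + δ) • (Hᵀ * P * H) + (1 + δ⁻¹) • (Dᵀ * P * D) := by
  have h1 := smul_mono_right (inv_pos.2 hδ).le (conj_nonneg hP (δ • H - D))
  rw [← sub_nonneg]
  rw [smul_zero] at h1
  convert h1 using 1
  simp only [Matrix.transpose_add, Matrix.transpose_sub, Matrix.transpose_smul, Matrix.add_mul,
    Matrix.mul_add, Matrix.sub_mul, Matrix.mul_sub, Matrix.smul_mul, Matrix.mul_smul, smul_sub,
    smul_smul, inv_mul_cancel₀ hδ.ne', one_smul, ← mul_assoc, one_mul, add_smul]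
  abel

/-- With δ so small that δP ≤ 1/4, Young's inequality keeps half of the Lyapunov decrement and
charges the rest to D'D. -/
theorem exists_conj_add_le {n : ℕ} {H P : Matrix (Fin n) (Fin n) ℝ} (hP : 1 ≤ P)
    (hH : Hᵀ * P * H ≤ P - (1 / 2 : ℝ) • (1 : Matrix (Fin n) (Fin n) ℝ)) :
    ∃ m : ℝ, 0 < m ∧ ∀ D : Matrix (Fin n) (Fin n) ℝ, (H + D)ᵀ * P * (H + D) ≤
      P - (1 / 4 : ℝ) • (1 : Matrix (Fin n) (Fin n) ℝ) + m • (Dᵀ * D) := by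
  have hP0 : 0 ≤ P := zero_le_one_matrix.trans hP
  have hPn := le_norm_smul_one (isSymm_of_nonneg hP0)
  have hp := norm_nonneg P
  set δ : ℝ := (4 * (‖P‖ + 1))⁻¹ with hδ
  have hδ0 : 0 < δ := by positivity
  have hδP : δ * ‖P‖ ≤ 1 / 4 := by
    rw [hδ, inv_mul_le_iff₀ (by positivity)]; linarith
  refine ⟨(1 + δ⁻¹) * (‖P‖ + 1), by positivity, fun D => ?_⟩
  refine (conj_add_le hP0 hδ0 H D).trans (add_le_add ?_ ?_)
  · have h1 := smul_mono_right (by positivity : 0 ≤ 1 + δ) hH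
    refine h1.trans ?_
    have h2 : δ • P ≤ (1 / 4 : ℝ) • (1 : Matrix (Fin n) (Fin n) ℝ) := by
      refine (smul_mono_right hδ0.le hPn).trans ?_
      rw [smul_smul]
      exact smul_one_mono hδP
    have h3 : (0 : Matrix (Fin n) (Fin n) ℝ) ≤ (δ / 2) • 1 := by
      simpa using smul_mono_right (by positivity : 0 ≤ δ / 2) zero_le_one_matrix
    rw [← sub_nonneg] at h2 ⊢
    refine (add_nonneg h2 h3).trans_eq ?_
    module
  · rw [mul_smul]
    refine smul_mono_right (by positivity) ?_
    have h1 := conj_mono hPn D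
    rw [Matrix.mul_smul, Matrix.mul_one, Matrix.smul_mul] at h1
    exact h1.trans (smul_mono_left (by linarith) (transpose_mul_self_nonneg D))

theorem sub_transpose_mul_sub_le {n p m : ℕ} (B : Matrix (Fin n) (Fin p) ℝ)
    (L : Matrix (Fin n) (Fin m) ℝ) : ∃ b : ℝ, 0 < b ∧ ∀ (K : Matrix (Fin p) (Fin n) ℝ)
      (C : Matrix (Fin m) (Fin n) ℝ),
      (B * K + L * C)ᵀ * (B * K + L * C) ≤ b • (Kᵀ * K + Cᵀ * C) := by
  have key : ∀ {l : ℕ} (B : Matrix (Fin n) (Fin l) ℝ) (K : Matrix (Fin l) (Fin n) ℝ) (b : ℝ),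
      ‖B‖ ^ 2 ≤ b → (B * K)ᵀ * (B * K) ≤ b • (Kᵀ * K) := by
    intro l B K b hb
    have h1 := conj_mono (transpose_mul_self_le B) K
    rw [Matrix.mul_smul, Matrix.mul_one, Matrix.smul_mul] at h1
    rw [Matrix.transpose_mul, Matrix.mul_assoc, ← Matrix.mul_assoc Bᵀ, ← Matrix.mul_assoc Kᵀ]
    exact h1.trans (smul_mono_left hb (transpose_mul_self_nonneg K))
  refine ⟨2 * (‖B‖ ^ 2 + ‖L‖ ^ 2 + 1), by positivity, fun K C => ?_⟩
  have h1 := conj_add_le zero_le_one_matrix one_pos (B * K) (L * C)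
  simp only [Matrix.mul_one] at h1
  refine h1.trans ?_
  have h2 := key B K (‖B‖ ^ 2 + ‖L‖ ^ 2 + 1) (by nlinarith [sq_nonneg ‖L‖])
  have h3 := key L C (‖B‖ ^ 2 + ‖L‖ ^ 2 + 1) (by nlinarith [sq_nonneg ‖B‖])
  have h4 := smul_mono_right (by norm_num : (0 : ℝ) ≤ 2) (add_le_add h2 h3)
  rw [← smul_add, smul_smul, smul_add] at h4
  convert h4 using 3 <;> norm_num

/-- A uniform bound on Riccati sequences with bounded penalties. -/
theorem IsStabilizable.exists_riccati_le {n p : ℕ} {A : Matrix (Fin n) (Fin n) ℝ}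
    {B : Matrix (Fin n) (Fin p) ℝ} {R : Matrix (Fin p) (Fin p) ℝ} (hAB : IsStabilizable A B)
    (hR : R.PosDef) {M : ℝ} (hM : 0 ≤ M) :
    ∃ c : ℝ, 0 < c ∧ ∀ X q : ℕ → Matrix (Fin n) (Fin n) ℝ, 0 ≤ X 0 → X 0 ≤ M • 1 →
      (∀ k, 0 ≤ q k) → (∀ k, q k ≤ M • 1) → (∀ k, X (k + 1) = costStep A B R (X k) + q k) →
      ∀ k, 0 ≤ X k ∧ X k ≤ c • 1 := by
  obtain ⟨K, hK⟩ := hAB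
  obtain ⟨P, hP1, hP⟩ := hK.exists_lyapunov
  have hR0 : 0 ≤ R := Matrix.nonneg_iff_posSemidef.2 hR.posSemidef
  have hP0 : 0 ≤ P := zero_le_one_matrix.trans hP1
  set m := ‖Kᵀ * R * K‖ with hm
  have hm0 : 0 ≤ m := norm_nonneg _
  have hKRK : Kᵀ * R * K ≤ m • 1 := le_norm_smul_one (isSymm_of_nonneg (conj_nonneg hR0 K))
  refine ⟨2 * (M + m) * ‖P‖ + 1, by positivity, fun X q hX0 hXM hq0 hqM hX k => ?_⟩
  have h0 : ∀ k, 0 ≤ X k := by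
    intro k
    induction k with
    | zero => exact hX0
    | succ k ih => rw [hX]; exact add_nonneg (costStep_nonneg ih hR0) (hq0 k)
  -- The multiple 2(M + m) of P is invariant: a step with the fixed gain K costs at most m + M,
  -- which is exactly what the decrement 1/2 of P gives back.
  have h1 : ∀ k, X k ≤ (2 * (M + m)) • P := by
    intro k
    induction k with
    | zero =>
      exact hXM.trans ((smul_mono_right hM hP1).trans (smul_mono_left (by linarith) hP0))
    | succ k ih =>
      rw [hX]
      have h2 := costStep_le (h0 k) hR (A := A) (B := B) K
      have h3 := conj_mono ih (A + B * K)
      rw [Matrix.mul_smul, Matrix.smul_mul] at h3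
      have h4 := smul_mono_right (by positivity : 0 ≤ 2 * (M + m)) hP
      refine (add_le_add (h2.trans (add_le_add (h3.trans h4) hKRK)) (hqM k)).trans_eq ?_
      module
  refine ⟨h0 k, (h1 k).trans ?_⟩
  refine (smul_mono_right (by positivity) (le_norm_smul_one (isSymm_of_nonneg hP0))).trans ?_
  rw [smul_smul]
  exact smul_one_mono (by linarith)

theorem exists_transition_le {n p m : ℕ} {A : Matrix (Fin n) (Fin n) ℝ}
    {B : Matrix (Fin n) (Fin p) ℝ} {R : Matrix (Fin p) (Fin p) ℝ} {C : Matrix (Fin m) (Fin n) ℝ}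
    (hAB : IsStabilizable A B) (hAC : IsDetectable A C) (hR : R.PosDef) {M : ℝ} (hM : 0 ≤ M) :
    ∃ c ρ : ℝ, 0 < c ∧ 0 < ρ ∧ ρ < 1 ∧ ∀ X q : ℕ → Matrix (Fin n) (Fin n) ℝ, 0 ≤ X 0 →
      X 0 ≤ M • 1 → (∀ k, Cᵀ * C ≤ q k) → (∀ k, q k ≤ M • 1) →
      (∀ k, X (k + 1) = costStep A B R (X k) + q k) →
      (∀ k, 0 ≤ X k ∧ X k ≤ c • 1) ∧ ∀ k j, ‖transition A B R X k j‖ ≤ c * ρ ^ j := by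
  obtain ⟨c₀, hc₀, hbound⟩ := hAB.exists_riccati_le hR hM
  obtain ⟨L, hL⟩ := hAC
  obtain ⟨P, hP1, hP⟩ := hL.exists_lyapunov
  have hP0 : 0 ≤ P := zero_le_one_matrix.trans hP1
  have hPn := le_norm_smul_one (isSymm_of_nonneg hP0)
  have hp := norm_nonneg P
  obtain ⟨m₁, hm₁, hpert⟩ := exists_conj_add_le hP1 hP
  obtain ⟨b, hb, hBL⟩ := sub_transpose_mul_sub_le B (-L)
  obtain ⟨r, hr, hrR⟩ := exists_smul_one_le_of_posDef hR
  -- This choice of ε makes the perturbation cost ε m₁ b (K'K + C'C) at most K'RK + q_k.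
  obtain ⟨ε, hε, hεr, hε1⟩ : ∃ ε : ℝ, 0 < ε ∧ ε * (m₁ * b) ≤ r ∧ ε * (m₁ * b) ≤ 1 := by
    refine ⟨min r 1 / (m₁ * b), by positivity, ?_, ?_⟩ <;>
      rw [div_mul_cancel₀ _ (by positivity)]
    · exact min_le_left _ _
    · exact min_le_right _ _
  -- Since X_k + εP ≤ u, a decrement of ε/4 is at least the fraction ε/(4u) of the Lyapunov
  -- function. The extra summand ε in u ensures θ > 0.
  set u := c₀ + ε * ‖P‖ + ε with hu
  have hu0 : 0 < u := by positivity
  set θ := 1 - ε / (4 * u) with hθ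
  have hθ1 : θ < 1 := by
    have : 0 < ε / (4 * u) := by positivity
    linarith
  have hθ0 : 0 < θ := by
    have : ε / (4 * u) < 1 := by
      rw [div_lt_one (by positivity)]
      have : 0 ≤ ε * ‖P‖ := by positivity
      linarith
    linarith
  refine ⟨c₀ + Real.sqrt (u / ε), Real.sqrt θ, by positivity, by positivity,
    (Real.sqrt_lt' one_pos).2 (by simpa using hθ1), fun X q hX0 hXM hqC hqM hX => ?_⟩
  have hXb := hbound X q hX0 hXM (fun k => (transpose_mul_self_nonneg C).trans (hqC k)) hqM hX
  refine ⟨fun k => ⟨(hXb k).1, (hXb k).2.trans (smul_one_mono (by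
    linarith [Real.sqrt_nonneg (u / ε)]))⟩, fun k j => ?_⟩
  have hU : ∀ k, X k + ε • P ≤ u • 1 := by
    intro k
    refine (add_le_add (hXb k).2 (smul_mono_right hε.le hPn)).trans ?_
    rw [smul_smul, ← add_smul]
    exact smul_one_mono (by linarith)
  have hstep : ∀ k, (closedLoop A B R (X k))ᵀ * (X k + ε • P) * closedLoop A B R (X k) ≤
      θ • (X (k + 1) + ε • P) := by
    intro k
    set K := gain A B R (X k) with hK
    have h1 : closedLoop A B R (X k) = (A + L * C) + (B * K + -L * C) := by
      rw [closedLoop, Matrix.neg_mul]; abel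
    have h2 := hpert (B * K + -L * C)
    rw [← h1] at h2
    have h3 := h2.trans (add_le_add_right (smul_mono_right hm₁.le (hBL K C)) _)
    have h4 := smul_mono_right hε.le h3
    have h5 : (ε * (m₁ * b)) • (Kᵀ * K) ≤ Kᵀ * R * K := by
      refine (smul_mono_left hεr (transpose_mul_self_nonneg K)).trans ?_
      have := conj_mono hrR K
      rwa [Matrix.mul_smul, Matrix.mul_one, Matrix.smul_mul] at this
    have h6 : (ε * (m₁ * b)) • (Cᵀ * C) ≤ q k := by
      refine (smul_mono_left hε1 (transpose_mul_self_nonneg C)).trans ?_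
      rw [one_smul]
      exact hqC k
    have h7 : (ε / (4 * u)) • (X (k + 1) + ε • P) ≤ (ε / 4) • 1 := by
      refine (smul_mono_right (by positivity) (hU (k + 1))).trans_eq ?_
      rw [smul_smul]
      congr 1
      field_simp
    rw [Matrix.mul_add, Matrix.add_mul, Matrix.mul_smul, Matrix.smul_mul]
    have h8 := add_le_add (add_le_add (add_le_add h4 h5) h6) h7
    rw [← sub_nonneg] at h8 ⊢
    refine h8.trans_eq ?_
    rw [hθ, hX k, costStep, ← hK]
    module
  have hiter : ∀ j, (transition A B R X k j)ᵀ * (X k + ε • P) * transition A B R X k j ≤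
      θ ^ j • (X (k + j) + ε • P) := by
    intro j
    induction j with
    | zero => simp [transition]
    | succ j ih =>
      have h1 := conj_mono ih (closedLoop A B R (X (k + j)))
      rw [Matrix.mul_smul, Matrix.smul_mul] at h1
      have h2 := smul_mono_right (pow_nonneg hθ0.le j) (hstep (k + j))
      rw [smul_smul, ← pow_succ] at h2
      refine le_trans (le_of_eq ?_) (h1.trans h2)
      simp only [transition, Matrix.transpose_mul, Matrix.mul_assoc]
  -- The Lyapunov function lies between ε and u, so its decay turns into decay of the norm.
  have h1 : (transition A B R X k j)ᵀ * transition A B R X k j ≤ (θ ^ j * (u / ε)) • 1 := by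
    have h2 : ε • (1 : Matrix (Fin n) (Fin n) ℝ) ≤ X k + ε • P := by
      simpa using add_le_add (hXb k).1 (smul_mono_right hε.le hP1)
    have h3 := (conj_mono h2 (transition A B R X k j)).trans
      ((hiter j).trans (smul_mono_right (pow_nonneg hθ0.le j) (hU (k + j))))
    rw [Matrix.mul_smul, Matrix.mul_one, Matrix.smul_mul, smul_smul] at h3
    have h4 := smul_mono_right (inv_pos.2 hε).le h3
    rw [smul_smul, smul_smul, inv_mul_cancel₀ hε.ne', one_smul] at h4
    refine h4.trans_eq ?_
    congr 1
    field_simp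
  have h2 := norm_sq_le_of_transpose_mul_self_le (by positivity) h1
  have h3 : (Real.sqrt (u / ε) * Real.sqrt θ ^ j) ^ 2 = θ ^ j * (u / ε) := by
    rw [mul_pow, Real.sq_sqrt (by positivity), ← pow_mul, mul_comm j 2, pow_mul,
      Real.sq_sqrt hθ0.le, mul_comm]
  rw [← h3] at h2
  refine (abs_le_of_sq_le_sq' h2 (by positivity)).2.trans ?_
  exact mul_le_mul_of_nonneg_right (by linarith) (by positivity)

/-! ### Stabilizing solutions -/

section Stabilizing

variable {n p m : ℕ} {A : Matrix (Fin n) (Fin n) ℝ} {B : Matrix (Fin n) (Fin p) ℝ}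
  {R : Matrix (Fin p) (Fin p) ℝ} {Q : Matrix (Fin n) (Fin n) ℝ}

theorem norm_mul_mul_le {a b c d : ℕ} (M : Matrix (Fin a) (Fin b) ℝ) (N : Matrix (Fin b) (Fin c) ℝ)
    (O : Matrix (Fin c) (Fin d) ℝ) : ‖M * N * O‖ ≤ ‖M‖ * ‖N‖ * ‖O‖ :=
  (Matrix.l2_opNorm_mul _ _).trans
    (mul_le_mul_of_nonneg_right (Matrix.l2_opNorm_mul _ _) (norm_nonneg _))

theorem IsStabilizingControl.costStep_add {V : Matrix (Fin n) (Fin n) ℝ}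
    (hV : IsStabilizingControl A B Q R V) : costStep A B R V + Q = V :=
  (dare_iff Q hV.isUnit).1 hV.dare

/-- V₁ − V₂ equals (F₁^j)'(V₁ − V₂)F₂^j for every j, and the right-hand side tends to zero. No sign
of V₁ or V₂ is required. -/
theorem IsStabilizingControl.eq {V₁ V₂ : Matrix (Fin n) (Fin n) ℝ} (hR : Rᵀ = R)
    (h₁ : IsStabilizingControl A B Q R V₁) (h₂ : IsStabilizingControl A B Q R V₂) : V₁ = V₂ := by
  obtain ⟨c₁, ρ₁, hc₁, hρ₁, hρ₁', hF₁⟩ := h₁.stable.exists_norm_pow_le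
  obtain ⟨c₂, ρ₂, hc₂, hρ₂, hρ₂', hF₂⟩ := h₂.stable.exists_norm_pow_le
  have hle : ∀ j : ℕ, ‖V₁ - V₂‖ ≤ c₁ * ρ₁ ^ j * ‖V₁ - V₂‖ * c₂ := by
    intro j
    have h := riccati_sub_eq (X := fun _ => V₁) (Y := fun _ => V₂) (q := fun _ => Q)
      (r := fun _ => Q) (fun _ => h₁.isUnit) (fun _ => h₂.isUnit) (fun _ => h₁.symm) hR
      (fun _ => h₁.costStep_add.symm) (fun _ => h₂.costStep_add.symm) 0 j
    simp only [sub_self, Matrix.mul_zero, Matrix.zero_mul, Finset.sum_const_zero, add_zero,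
      transition_const] at h
    calc ‖V₁ - V₂‖ = _ := congr_arg _ h
      _ ≤ _ := norm_mul_mul_le _ _ _
      _ ≤ _ := by
        rw [norm_transpose]
        refine mul_le_mul (mul_le_mul_of_nonneg_right (hF₁ j) (norm_nonneg _)) ?_ (norm_nonneg _)
          (by positivity)
        exact (hF₂ j).trans (mul_le_of_le_one_right hc₂.le (pow_le_one₀ hρ₂.le hρ₂'.le))
  have hlim : Filter.Tendsto (fun j : ℕ => c₁ * ρ₁ ^ j * ‖V₁ - V₂‖ * c₂) Filter.atTop (nhds 0) := by
    simpa using (((tendsto_pow_atTop_nhds_zero_of_lt_one hρ₁.le hρ₁').const_mul c₁).mul_const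
      ‖V₁ - V₂‖).mul_const c₂
  have := ge_of_tendsto' hlim hle
  exact sub_eq_zero.1 (norm_le_zero_iff.1 this)

theorem exists_stabilizingControl {C : Matrix (Fin m) (Fin n) ℝ} (hAB : IsStabilizable A B)
    (hAC : IsDetectable A C) (hR : R.PosDef) (hQ : Cᵀ * C ≤ Q) :
    ∃ V, 0 ≤ V ∧ IsStabilizingControl A B Q R V := by
  have hRs := transpose_eq_of_posDef hR
  have hQ0 : 0 ≤ Q := (transpose_mul_self_nonneg C).trans hQ
  have hQn := le_norm_smul_one (isSymm_of_nonneg hQ0)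
  obtain ⟨c, ρ, hc, hρ0, hρ1, hbound⟩ := exists_transition_le hAB hAC hR (norm_nonneg Q)
  let X : ℕ → Matrix (Fin n) (Fin n) ℝ := fun k => (fun Y => costStep A B R Y + Q)^[k] 0
  have hX : ∀ k, X (k + 1) = costStep A B R (X k) + Q := fun k =>
    Function.iterate_succ_apply' _ _ _
  have hX1 : X 1 = Q := by
    rw [hX 0]
    simp [X, costStep, gain]
  obtain ⟨hXb, hXt⟩ := hbound X (fun _ => Q) le_rfl
    (by simpa [X] using smul_mono_right (norm_nonneg Q) zero_le_one_matrix)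
    (fun _ => hQ) (fun _ => hQn) hX
  -- The shifted sequence starts at Q, so the bound ‖Q‖ serves both sequences. Their penalties
  -- agree, and X_k − X_{k+1} is X_0 − X_1 between two transition matrices, hence geometrically
  -- small.
  obtain ⟨hYb, hYt⟩ := hbound (fun k => X (k + 1)) (fun _ => Q) (by simpa [hX1] using hQ0)
    (by simpa [hX1] using hQn) (fun _ => hQ) (fun _ => hQn) (fun k => hX (k + 1))
  have hXu : ∀ k, IsUnit (Bᵀ * X k * B + R) := fun k => isUnit_of_nonneg (hXb k).1 hR
  have hcauchy : CauchySeq X := by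
    refine cauchySeq_of_le_geometric ρ (c * ‖X 0 - X 1‖ * c) hρ1 fun k => ?_
    have h := riccati_sub_eq (X := X) (Y := fun k => X (k + 1)) hXu (fun k => hXu (k + 1))
      (fun k => isSymm_of_nonneg (hXb k).1) hRs hX (fun k => hX (k + 1)) 0 k
    simp only [sub_self, Matrix.mul_zero, Matrix.zero_mul, Finset.sum_const_zero, add_zero,
      zero_add] at h
    rw [dist_eq_norm, h]
    refine (norm_mul_mul_le _ _ _).trans ?_
    rw [norm_transpose]
    have h1 := hXt 0 k
    have h2 := (hYt 0 k).trans
      (mul_le_of_le_one_right hc.le (pow_le_one₀ hρ0.le hρ1.le))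
    calc _ ≤ c * ρ ^ k * ‖X 0 - X 1‖ * c := mul_le_mul (mul_le_mul_of_nonneg_right h1
          (norm_nonneg _)) h2 (norm_nonneg _) (by positivity)
      _ = _ := by ring
  obtain ⟨V, hV⟩ := cauchySeq_tendsto_of_complete hcauchy
  have hV0 : 0 ≤ V := isClosed_nonneg.mem_of_tendsto hV (Filter.Eventually.of_forall
    fun k => (hXb k).1)
  have hVu : IsUnit (Bᵀ * V * B + R) := isUnit_of_nonneg hV0 hR
  -- Continuity of the Riccati map along the sequence follows from the difference identity, as the
  -- closed loops of the X_k are uniformly bounded.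
  have hcost : Filter.Tendsto (fun k => costStep A B R (X k)) Filter.atTop
      (nhds (costStep A B R V)) := by
    rw [tendsto_iff_norm_sub_tendsto_zero] at hV ⊢
    refine squeeze_zero (fun _ => norm_nonneg _) (g := fun k =>
      c * ρ ^ 1 * ‖X k - V‖ * ‖closedLoop A B R V‖) (fun k => ?_) ?_
    · rw [costStep_sub (hXu k) hVu (isSymm_of_nonneg (hXb k).1) hRs]
      refine (norm_mul_mul_le _ _ _).trans ?_
      rw [norm_transpose]
      have h1 := hXt k 1
      simp only [transition, Matrix.one_mul, add_zero] at h1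
      gcongr
    · simpa only [mul_zero, zero_mul] using (hV.const_mul (c * ρ ^ 1)).mul_const ‖closedLoop A B R V‖
  have hfix : costStep A B R V + Q = V := by
    refine tendsto_nhds_unique ?_ ((Filter.tendsto_add_atTop_iff_nat 1).2 hV)
    simpa only [hX] using hcost.add_const Q
  refine ⟨V, hV0, isSymm_of_nonneg hV0, hVu, (dare_iff Q hVu).2 hfix, ?_⟩
  -- The constant sequence V is itself a Riccati sequence, and its transition matrices are the
  -- powers of the closed loop. The bound must now cover the starting value V as well.
  obtain ⟨c', ρ', hc', hρ0', hρ1', hbound'⟩ := exists_transition_le hAB hAC hR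
    (le_max_of_le_left (norm_nonneg Q) : 0 ≤ max ‖Q‖ ‖V‖)
  refine isStable_of_norm_pow_le hρ0'.le hρ1' (c := c') fun j => ?_
  rw [← transition_const V 0 j]
  exact (hbound' (fun _ => V) (fun _ => Q) hV0 ((le_norm_smul_one (isSymm_of_nonneg hV0)).trans
    (smul_one_mono (le_max_right _ _))) (fun _ => hQ) (fun _ => hQn.trans
    (smul_one_mono (le_max_left _ _))) (fun _ => hfix.symm)).2 0 j

/-- Exponential convergence of the Riccati iteration with constant penalty, started from zero. -/
theorem IsStabilizingControl.exists_norm_sub_le {C : Matrix (Fin m) (Fin n) ℝ}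
    {V : Matrix (Fin n) (Fin n) ℝ} (hV : IsStabilizingControl A B Q R V)
    (hAB : IsStabilizable A B) (hAC : IsDetectable A C) (hR : R.PosDef) (hQ : Cᵀ * C ≤ Q)
    {X : ℕ → Matrix (Fin n) (Fin n) ℝ} (hX0 : X 0 = 0)
    (hX : ∀ k, 0 ≤ X k → X (k + 1) = costStep A B R (X k) + Q) :
    ∃ c ρ : ℝ, 0 < c ∧ 0 < ρ ∧ ρ < 1 ∧ (∀ k, 0 ≤ X k) ∧
      ∀ k j, ‖X (k + j) - V‖ ≤ c * ρ ^ j * ‖X k - V‖ := by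
  have hRs := transpose_eq_of_posDef hR
  have hQ0 : 0 ≤ Q := (transpose_mul_self_nonneg C).trans hQ
  have hQn := le_norm_smul_one (isSymm_of_nonneg hQ0)
  obtain ⟨c, ρ, hc, hρ0, hρ1, hbound⟩ := exists_transition_le hAB hAC hR (norm_nonneg Q)
  obtain ⟨c₁, ρ₁, hc₁, hρ₁, hρ₁', hF⟩ := hV.stable.exists_norm_pow_le
  -- The recursion is assumed only at nonnegative iterates, so nonnegativity is carried along by
  -- induction.
  have hXn : ∀ k, 0 ≤ X k := by
    intro k
    induction k with
    | zero => exact hX0.ge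
    | succ k ih =>
      rw [hX k ih]
      exact add_nonneg (costStep_nonneg ih (Matrix.nonneg_iff_posSemidef.2 hR.posSemidef)) hQ0
  have hX' : ∀ k, X (k + 1) = costStep A B R (X k) + Q := fun k => hX k (hXn k)
  obtain ⟨-, hXt⟩ := hbound X (fun _ => Q) (hXn 0)
    (by simpa [hX0] using smul_mono_right (norm_nonneg Q) zero_le_one_matrix)
    (fun _ => hQ) (fun _ => hQn) hX'
  refine ⟨c * c₁, ρ, mul_pos hc hc₁, hρ0, hρ1, hXn, fun k j => ?_⟩
  -- The comparison starts at an arbitrary k, which yields contraction from every time; the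
  -- finite-time error bound depends on this.
  have h := riccati_sub_eq (X := X) (Y := fun _ => V) (fun k => isUnit_of_nonneg (hXn k) hR)
    (fun _ => hV.isUnit) (fun k => isSymm_of_nonneg (hXn k)) hRs hX'
    (fun _ => hV.costStep_add.symm) k j
  simp only [sub_self, Matrix.mul_zero, Matrix.zero_mul, Finset.sum_const_zero, add_zero,
    transition_const] at h
  rw [h]
  refine (norm_mul_mul_le _ _ _).trans ?_
  rw [norm_transpose]
  have h2 := (hF j).trans (mul_le_of_le_one_right hc₁.le (pow_le_one₀ hρ₁.le hρ₁'.le))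
  calc _ ≤ c * ρ ^ j * ‖X k - V‖ * c₁ := mul_le_mul (mul_le_mul_of_nonneg_right (hXt k j)
        (norm_nonneg _)) h2 (norm_nonneg _) (by positivity)
    _ = _ := by ring

end Stabilizing

/-! ### Duality between filter and control -/

section Duality

variable {n m : ℕ} {A : Matrix (Fin n) (Fin n) ℝ} {C : Matrix (Fin m) (Fin n) ℝ}
  {W : Matrix (Fin n) (Fin n) ℝ} {S : Matrix (Fin m) (Fin m) ℝ} {X : Matrix (Fin n) (Fin n) ℝ}

theorem filterStep_eq (hX : IsUnit (C * X * Cᵀ + S)) :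
    filterStep A C W S X = costStep Aᵀ Cᵀ S X + W := by
  rw [costStep_eq (by simpa using hX), filterStep, closedLoop, gain]
  simp only [Matrix.transpose_transpose, Matrix.mul_add, Matrix.mul_neg, Matrix.mul_assoc]
  abel

/-- The closed loop of the dual problem is the transpose of the filter error matrix, and stability
is invariant under transposition. -/
theorem isStabilizingFilter_iff (hS : Sᵀ = S) :
    IsStabilizingFilter A C W S X ↔ IsStabilizingControl Aᵀ Cᵀ W S X := by
  have key : X.IsSymm → closedLoop Aᵀ Cᵀ S X =
      (A - A * X * Cᵀ * (C * X * Cᵀ + S)⁻¹ * C)ᵀ := by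
    intro hX
    rw [closedLoop, gain]
    simp [Matrix.transpose_mul, Matrix.transpose_nonsing_inv, hX.eq, hS, Matrix.mul_assoc,
      sub_eq_add_neg]
  constructor
  · intro h
    refine ⟨h.symm, by simpa using h.isUnit, by simpa using h.dare, ?_⟩
    rw [key h.symm]
    exact h.stable.transpose
  · intro h
    refine ⟨h.symm, by simpa using h.isUnit, by simpa using h.dare, ?_⟩
    have := h.stable
    rw [key h.symm] at this
    simpa using this.transpose

theorem IsDetectable.transpose (h : IsDetectable A C) : IsStabilizable Aᵀ Cᵀ := by
  obtain ⟨L, hL⟩ := h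
  exact ⟨Lᵀ, by simpa [Matrix.transpose_add, Matrix.transpose_mul] using hL.transpose⟩

theorem IsStabilizable.transpose {B : Matrix (Fin n) (Fin m) ℝ} (h : IsStabilizable A B) :
    IsDetectable Aᵀ Bᵀ := by
  obtain ⟨K, hK⟩ := h
  exact ⟨Kᵀ, by simpa [Matrix.transpose_add, Matrix.transpose_mul] using hK.transpose⟩

theorem sqrt_transpose_mul_sqrt (hW : 0 ≤ W) : (CFC.sqrt W)ᵀ * CFC.sqrt W = W := by
  rw [isSymm_of_nonneg (CFC.sqrt_nonneg W), CFC.sqrt_mul_sqrt_self W hW]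

/-- x'Wx is the variance of x·w₀; the Gaussian law provides the finite second moments. -/
theorem IsGaussianNoise.cov_nonneg {Ω : Type*} [MeasurableSpace Ω]
    {P : MeasureTheory.Measure Ω} [MeasureTheory.IsProbabilityMeasure P]
    {w : ℤ → Ω → (Fin n → ℝ)} {v : ℤ → Ω → (Fin m → ℝ)} {wbar : Fin n → ℝ}
    (h : IsGaussianNoise P w v wbar W S) : 0 ≤ W := by
  have hL : ∀ i, MeasureTheory.MemLp (fun ω => w 0 ω i) 2 P := fun i =>
    ((h.gaussian 0).fst.eval i).memLp_two
  refine le_of_dotProduct_mulVec_le (by simp) ?_ fun x => ?_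
  · ext i j
    rw [Matrix.transpose_apply, ← h.cov_w 0 j i, ← h.cov_w 0 i j,
      ProbabilityTheory.covariance_comm]
  · have hx : ∀ i, MeasureTheory.MemLp (fun ω => x i * w 0 ω i) 2 P := fun i =>
      (hL i).const_mul (x i)
    have h1 : ProbabilityTheory.covariance (fun ω => ∑ i, x i * w 0 ω i)
        (fun ω => ∑ i, x i * w 0 ω i) P = x ⬝ᵥ W *ᵥ x := by
      rw [ProbabilityTheory.covariance_fun_sum_fun_sum hx hx]
      simp only [ProbabilityTheory.covariance_const_mul_left,
        ProbabilityTheory.covariance_const_mul_right, h.cov_w, dotProduct, Matrix.mulVec,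
        Finset.mul_sum]
      refine Finset.sum_congr rfl fun i _ => Finset.sum_congr rfl fun j _ => by ring
    rw [← h1, ProbabilityTheory.covariance_self]
    · simp [ProbabilityTheory.variance_nonneg]
    · exact (MeasureTheory.memLp_finsetSum Finset.univ
        fun i _ => hx i).aestronglyMeasurable.aemeasurable

end Duality

/-! ### Error bounds for the backward recursions -/

theorem sum_pow_sub_le {ρ : ℝ} (h0 : 0 ≤ ρ) (h1 : ρ < 1) (j : ℕ) :
    ∑ i ∈ Finset.range j, ρ ^ (j - 1 - i) ≤ (1 - ρ)⁻¹ := by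
  rw [Finset.sum_range_reflect (fun i => ρ ^ i) j, ← tsum_geometric_of_lt_one h0 h1]
  exact (summable_geometric_of_lt_one h0 h1).sum_le_tsum _ fun i _ => pow_nonneg h0 i

theorem sum_pow_sub_mul_pow_le {ρ σ : ℝ} (h0 : 0 ≤ ρ) (h1 : ρ < σ) (j : ℕ) :
    ∑ i ∈ Finset.range j, ρ ^ (j - 1 - i) * σ ^ i ≤ (σ - ρ)⁻¹ * σ ^ j := by
  have h := geom_sum₂_mul σ ρ j
  have h2 : ∑ i ∈ Finset.range j, ρ ^ (j - 1 - i) * σ ^ i =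
      ∑ i ∈ Finset.range j, σ ^ i * ρ ^ (j - 1 - i) :=
    Finset.sum_congr rfl fun i _ => mul_comm _ _
  rw [h2, inv_mul_eq_div, le_div_iff₀ (sub_pos.2 h1), h]
  linarith [pow_nonneg h0 j]

theorem eucNorm_sum_le {n : ℕ} {ι : Type*} (s : Finset ι) (f : ι → Fin n → ℝ) :
    eucNorm (∑ i ∈ s, f i) ≤ ∑ i ∈ s, eucNorm (f i) := by
  simpa [eucNorm, WithLp.toLp_sum] using norm_sum_le s fun i => WithLp.toLp 2 (f i)

section Bounds

variable {n p : ℕ} {A : Matrix (Fin n) (Fin n) ℝ} {B : Matrix (Fin n) (Fin p) ℝ}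
  {R : Matrix (Fin p) (Fin p) ℝ}

/-- In the initial-error term the left transition is merely bounded by c, while the right one is
kept as a power of the limiting closed loop. In the sum the roles are reversed: the left transitions
decay and give (1 − ρ)⁻¹, and the right ones are bounded by a. -/
theorem IsStabilizingControl.norm_riccati_sub_le {Q V : Matrix (Fin n) (Fin n) ℝ}
    {X q : ℕ → Matrix (Fin n) (Fin n) ℝ} (hV : IsStabilizingControl A B Q R V) (hR : R.PosDef)
    (hX0 : ∀ k, 0 ≤ X k) (hX : ∀ k, X (k + 1) = costStep A B R (X k) + q k) {c ρ a D ω : ℝ}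
    (hc : 0 ≤ c) (hρ0 : 0 ≤ ρ) (hρ1 : ρ < 1) (hω : 0 ≤ ω)
    (ht : ∀ k j, ‖transition A B R X k j‖ ≤ c * ρ ^ j)
    (ha : ∀ j, ‖closedLoop A B R V ^ j‖ ≤ a) (hD : ‖X 0 - V‖ ≤ D) (j : ℕ)
    (hq : ∀ i < j, ‖q i - Q‖ ≤ ω) :
    ‖X j - V‖ ≤ c * D * ‖closedLoop A B R V ^ j‖ + c * a * (1 - ρ)⁻¹ * ω := by
  have ha0 : 0 ≤ a := (norm_nonneg _).trans (ha 0)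
  have h := riccati_sub_eq (X := X) (Y := fun _ => V) (fun k => isUnit_of_nonneg (hX0 k) hR)
    (fun _ => hV.isUnit) (fun k => isSymm_of_nonneg (hX0 k)) (transpose_eq_of_posDef hR) hX
    (fun _ => hV.costStep_add.symm) 0 j
  simp only [zero_add, transition_const] at h
  rw [h]
  refine (norm_add_le _ _).trans (add_le_add ?_ ?_)
  · refine (norm_mul_mul_le _ _ _).trans ?_
    rw [norm_transpose]
    have h1 : ‖transition A B R X 0 j‖ ≤ c :=
      (ht 0 j).trans (mul_le_of_le_one_right hc (pow_le_one₀ hρ0 hρ1.le))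
    gcongr
  · refine (norm_sum_le _ _).trans ?_
    calc _ ≤ ∑ i ∈ Finset.range j, c * a * ω * ρ ^ (j - 1 - i) := by
          refine Finset.sum_le_sum fun i hi => (norm_mul_mul_le _ _ _).trans ?_
          rw [norm_transpose]
          calc _ ≤ c * ρ ^ (j - 1 - i) * ω * a := by
                gcongr
                · exact ht _ _
                · exact hq i (Finset.mem_range.1 hi)
                · exact ha _
            _ = _ := by ring
      _ ≤ c * a * ω * (1 - ρ)⁻¹ := by
          rw [← Finset.mul_sum]
          exact mul_le_mul_of_nonneg_left (sum_pow_sub_le hρ0 hρ1 j) (by positivity)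
      _ = _ := by ring

theorem affine_recursion_eq {X : ℕ → Matrix (Fin n) (Fin n) ℝ} {e g : ℕ → Fin n → ℝ}
    (he : ∀ k, e (k + 1) = (closedLoop A B R (X k))ᵀ *ᵥ e k + g k) (j : ℕ) :
    e j = (transition A B R X 0 j)ᵀ *ᵥ e 0 +
      ∑ i ∈ Finset.range j, (transition A B R X (i + 1) (j - 1 - i))ᵀ *ᵥ g i := by
  induction j with
  | zero => simp [transition]
  | succ j ih =>
    rw [he, Finset.sum_range_succ, ← add_assoc]
    congr 1
    · nth_rw 1 [ih]
      rw [Matrix.mulVec_add, Matrix.mulVec_sum]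
      congr 1
      · rw [transition, Matrix.transpose_mul, Matrix.mulVec_mulVec, zero_add]
      · refine Finset.sum_congr rfl fun i hi => ?_
        have hi := Finset.mem_range.1 hi
        have e1 : j + 1 - 1 - i = (j - 1 - i) + 1 := by omega
        have e2 : i + 1 + (j - 1 - i) = j := by omega
        rw [e1, transition, e2, Matrix.transpose_mul, Matrix.mulVec_mulVec]
    · simp [transition]

/-- Variation of constants turns the forcing into a convolution. The strict inequality ρ < σ avoids
a factor j in the convolution of the two geometric sequences, and τ is a part of the forcing that
stays fixed during the recursion. -/
theorem eucNorm_affine_recursion_le {X : ℕ → Matrix (Fin n) (Fin n) ℝ} {e g : ℕ → Fin n → ℝ}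
    (he : ∀ k, e (k + 1) = (closedLoop A B R (X k))ᵀ *ᵥ e k + g k) {c ρ σ b τ : ℝ}
    (hc : 0 ≤ c) (hρ0 : 0 ≤ ρ) (hρσ : ρ < σ) (hσ : σ < 1) (hb : 0 ≤ b)
    (ht : ∀ k j, ‖transition A B R X k j‖ ≤ c * ρ ^ j) (hτ : 0 ≤ τ) (j : ℕ)
    (hg : ∀ i < j, eucNorm (g i) ≤ b * (σ ^ i + τ)) :
    eucNorm (e j) ≤ c * (eucNorm (e 0) + b * ((σ - ρ)⁻¹ + (1 - ρ)⁻¹)) * (σ ^ j + τ) := by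
  have hσ0 : 0 ≤ σ := hρ0.trans hρσ.le
  have hρ1 : 0 < 1 - ρ := by linarith
  have hσρ : 0 < σ - ρ := by linarith
  have hσj := pow_nonneg hσ0 j
  have h0 := eucNorm_nonneg (e 0)
  have h1 : eucNorm ((transition A B R X 0 j)ᵀ *ᵥ e 0) ≤ c * σ ^ j * eucNorm (e 0) := by
    refine (eucNorm_mulVec_le _ _).trans ?_
    rw [norm_transpose]
    refine mul_le_mul_of_nonneg_right ((ht 0 j).trans ?_) h0
    gcongr
  have h2 : eucNorm (∑ i ∈ Finset.range j, (transition A B R X (i + 1) (j - 1 - i))ᵀ *ᵥ g i) ≤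
      c * b * ((σ - ρ)⁻¹ * σ ^ j + τ * (1 - ρ)⁻¹) := by
    refine (eucNorm_sum_le _ _).trans ?_
    calc _ ≤ ∑ i ∈ Finset.range j, c * b *
          (ρ ^ (j - 1 - i) * σ ^ i + τ * ρ ^ (j - 1 - i)) := by
          refine Finset.sum_le_sum fun i hi => (eucNorm_mulVec_le _ _).trans ?_
          rw [norm_transpose]
          refine (mul_le_mul (ht _ _) (hg i (Finset.mem_range.1 hi)) (eucNorm_nonneg _)
            (by positivity)).trans_eq ?_
          ring
      _ ≤ _ := by
          rw [← Finset.mul_sum, Finset.sum_add_distrib, ← Finset.mul_sum]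
          exact mul_le_mul_of_nonneg_left (add_le_add (sum_pow_sub_mul_pow_le hρ0 hρσ j)
            (mul_le_mul_of_nonneg_left (sum_pow_sub_le hρ0 (hρσ.trans hσ) j) hτ)) (by positivity)
  rw [affine_recursion_eq he j]
  refine (eucNorm_add_le _ _).trans ((add_le_add h1 h2).trans ?_)
  have h3 : 0 ≤ c * eucNorm (e 0) * τ + c * b * ((σ - ρ)⁻¹ * τ + (1 - ρ)⁻¹ * σ ^ j) := by
    positivity
  linarith

theorem exists_norm_gain_sub_le (hR : R.PosDef) {V : Matrix (Fin n) (Fin n) ℝ} (hV : 0 ≤ V) :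
    ∃ L : ℝ, 0 < L ∧ ∀ X, 0 ≤ X → ‖gain A B R X - gain A B R V‖ ≤ L * ‖X - V‖ := by
  obtain ⟨r, hr, hrR⟩ := exists_smul_one_le_of_posDef hR
  refine ⟨r⁻¹ * ‖B‖ * ‖closedLoop A B R V‖ + 1, by positivity, fun X hX => ?_⟩
  rw [gain_sub_gain (isUnit_of_nonneg hX hR) (isUnit_of_nonneg hV hR), norm_neg]
  have h1 := norm_inv_le hr (smul_one_le_add (B := B) hX hrR)
  calc _ ≤ ‖(Bᵀ * X * B + R)⁻¹‖ * ‖Bᵀ * (X - V) * closedLoop A B R V‖ :=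
        Matrix.l2_opNorm_mul _ _
    _ ≤ r⁻¹ * (‖Bᵀ‖ * ‖X - V‖ * ‖closedLoop A B R V‖) :=
        mul_le_mul h1 (norm_mul_mul_le _ _ _) (norm_nonneg _) (by positivity)
    _ ≤ _ := by
        rw [norm_transpose]
        nlinarith [norm_nonneg (X - V)]

/-- The affine terms solve linear systems with matrices B'XB + R and B'VB + R. Subtracting the
systems leaves only the inverse for X, which is bounded uniformly. -/
theorem exists_eucNorm_affineTerm_sub_le (hR : R.PosDef) {V : Matrix (Fin n) (Fin n) ℝ}
    (hV : 0 ≤ V) (z₀ : Fin n → ℝ) :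
    ∃ L : ℝ, 0 < L ∧ ∀ X, 0 ≤ X → ∀ z, eucNorm (affineTerm B R X z - affineTerm B R V z₀) ≤
      L * (eucNorm (z - z₀) + ‖X - V‖) := by
  obtain ⟨r, hr, hrR⟩ := exists_smul_one_le_of_posDef hR
  set a := affineTerm B R V z₀ with ha
  have ha0 := eucNorm_nonneg a
  refine ⟨r⁻¹ * ‖B‖ * (1 + ‖B‖ * eucNorm a) + 1, by positivity, fun X hX z => ?_⟩
  have hGX := (Matrix.isUnit_iff_isUnit_det _).1 (isUnit_of_nonneg (B := B) hX hR)
  have hGV := (Matrix.isUnit_iff_isUnit_det _).1 (isUnit_of_nonneg (B := B) hV hR)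
  have h1 : (Bᵀ * V * B + R) *ᵥ a = -(Bᵀ *ᵥ z₀) := by
    rw [ha, affineTerm, Matrix.mulVec_neg, Matrix.mulVec_mulVec, ← Matrix.mul_assoc,
      Matrix.mul_nonsing_inv _ hGV, Matrix.one_mul]
  have h2 : (Bᵀ * X * B + R) *ᵥ (affineTerm B R X z - a) =
      -(Bᵀ *ᵥ ((z - z₀) + (X - V) *ᵥ (B *ᵥ a))) := by
    have h3 : (Bᵀ * X * B + R) *ᵥ a =
        (Bᵀ * V * B + R) *ᵥ a + Bᵀ *ᵥ ((X - V) *ᵥ (B *ᵥ a)) := by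
      simp only [Matrix.mulVec_mulVec, ← Matrix.add_mulVec]
      congr 1
      simp only [Matrix.sub_mul, Matrix.mul_sub, Matrix.mul_assoc]
      abel
    rw [Matrix.mulVec_sub, h3, h1, affineTerm, Matrix.mulVec_neg, Matrix.mulVec_mulVec,
      ← Matrix.mul_assoc, Matrix.mul_nonsing_inv _ hGX, Matrix.one_mul, Matrix.mulVec_add,
      Matrix.mulVec_sub]
    abel
  have h4 : affineTerm B R X z - a =
      -((Bᵀ * X * B + R)⁻¹ *ᵥ (Bᵀ *ᵥ ((z - z₀) + (X - V) *ᵥ (B *ᵥ a)))) := by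
    rw [← Matrix.mulVec_neg, ← h2, Matrix.mulVec_mulVec, Matrix.nonsing_inv_mul _ hGX,
      Matrix.one_mulVec]
  have h5 := norm_inv_le hr (smul_one_le_add (B := B) hX hrR)
  have h6 : eucNorm ((z - z₀) + (X - V) *ᵥ (B *ᵥ a)) ≤
      eucNorm (z - z₀) + ‖X - V‖ * (‖B‖ * eucNorm a) :=
    (eucNorm_add_le _ _).trans (add_le_add le_rfl ((eucNorm_mulVec_le _ _).trans
      (mul_le_mul_of_nonneg_left (eucNorm_mulVec_le _ _) (norm_nonneg _))))
  have h7 := eucNorm_nonneg (z - z₀)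
  have h8 := norm_nonneg (X - V)
  rw [h4, eucNorm_neg]
  calc _ ≤ ‖(Bᵀ * X * B + R)⁻¹‖ * (‖Bᵀ‖ * eucNorm ((z - z₀) + (X - V) *ᵥ (B *ᵥ a))) :=
        (eucNorm_mulVec_le _ _).trans
          (mul_le_mul_of_nonneg_left (eucNorm_mulVec_le _ _) (norm_nonneg _))
    _ ≤ r⁻¹ * (‖B‖ * (eucNorm (z - z₀) + ‖X - V‖ * (‖B‖ * eucNorm a))) := by
        rw [norm_transpose]
        gcongr
        exact mul_nonneg (norm_nonneg _) (eucNorm_nonneg _)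
    _ ≤ _ := by
        have h9 : 0 ≤ r⁻¹ * ‖B‖ * (‖B‖ * eucNorm a * eucNorm (z - z₀) + ‖X - V‖) := by
          positivity
        nlinarith

theorem costVecLim_eq {V : Matrix (Fin n) (Fin n) ℝ} (h : IsStable (closedLoop A B R V))
    (wbar : Fin n → ℝ) : costVecLim A B R wbar V =
      (closedLoop A B R V)ᵀ *ᵥ (costVecLim A B R wbar V + V *ᵥ wbar) := by
  have hu := (Matrix.isUnit_iff_isUnit_det _).1 h.transpose.isUnit_one_sub
  have h1 : (1 - (closedLoop A B R V)ᵀ) *ᵥ costVecLim A B R wbar V =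
      (closedLoop A B R V)ᵀ *ᵥ (V *ᵥ wbar) := by
    rw [costVecLim, Matrix.mulVec_mulVec, Matrix.mulVec_mulVec, Matrix.mul_assoc,
      ← Matrix.mul_assoc (1 - _), Matrix.mul_nonsing_inv _ hu, Matrix.one_mul]
  rw [Matrix.sub_mulVec, Matrix.one_mulVec] at h1
  rw [Matrix.mulVec_add, ← h1, add_sub_cancel]

end Bounds

/-! ### Penalties inflated by the filter covariance -/

section Inflated

variable {n : ℕ} {Q X Y : Matrix (Fin n) (Fin n) ℝ} {μ : ℝ}

theorem norm_inflated_sub_le (hμ : 0 ≤ μ) :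
    ‖inflated Q μ X - inflated Q μ Y‖ ≤ 4 * μ * ‖Q‖ ^ 2 * ‖X - Y‖ := by
  have h : inflated Q μ X - inflated Q μ Y = (4 * μ) • (Q * (X - Y) * Q) := by
    rw [inflated, inflated, add_sub_add_left_eq_sub, ← smul_sub, Matrix.mul_sub, Matrix.sub_mul]
  rw [h, norm_smul, Real.norm_of_nonneg (by positivity)]
  calc _ ≤ 4 * μ * (‖Q‖ * ‖X - Y‖ * ‖Q‖) :=
        mul_le_mul_of_nonneg_left (norm_mul_mul_le _ _ _) (by positivity)
    _ = _ := by ring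

theorem le_inflated (hμ : 0 ≤ μ) (hQ : Qᵀ = Q) (hX : 0 ≤ X) : Q ≤ inflated Q μ X := by
  refine le_add_of_nonneg_right ?_
  have := smul_mono_right (by positivity : 0 ≤ 4 * μ) (conj_nonneg hX Q)
  rwa [smul_zero, hQ] at this

theorem inflated_le (hμ : 0 ≤ μ) (hQ : 0 ≤ Q) (hX : 0 ≤ X) {ω : ℝ} (hω : ‖X‖ ≤ ω) :
    inflated Q μ X ≤ (‖Q‖ + 4 * μ * ‖Q‖ ^ 2 * ω) • 1 := by
  have hQs := isSymm_of_nonneg hQ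
  refine (le_norm_smul_one (isSymm_of_nonneg (hQ.trans (le_inflated hμ hQs hX)))).trans
    (smul_one_mono ?_)
  have h := norm_inflated_sub_le (Q := Q) (X := X) (Y := 0) hμ
  have h0 : inflated Q μ 0 = Q := by simp [inflated]
  rw [h0, sub_zero] at h
  have h1 := norm_add_le (inflated Q μ X - Q) Q
  rw [sub_add_cancel] at h1
  have h2 := mul_le_mul_of_nonneg_left hω (by positivity : 0 ≤ 4 * μ * ‖Q‖ ^ 2)
  linarith

end Inflated

/-! ### Uniform bounds for the coupled filter and control recursions -/

/-- Bounds on the backward Riccati recursion that are uniform in the horizon and in the bounded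
filter covariances `Y`. -/
theorem exists_costMatAux_bounds {n p : ℕ} {A : Matrix (Fin n) (Fin n) ℝ}
    {B : Matrix (Fin n) (Fin p) ℝ} {Q : Matrix (Fin n) (Fin n) ℝ} {R : Matrix (Fin p) (Fin p) ℝ}
    {μ : ℝ} (hμ : 0 ≤ μ) (hAB : IsStabilizable A B) (hAQ : IsDetectable A (CFC.sqrt Q))
    (hQ : 0 ≤ Q) (hR : R.PosDef) {ω : ℝ} (hω : 0 ≤ ω) :
    ∃ c ρ : ℝ, 0 < c ∧ 0 < ρ ∧ ρ < 1 ∧ ∀ (Y : ℤ → Matrix (Fin n) (Fin n) ℝ) (N : ℤ),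
      (∀ s, 0 ≤ Y s) → (∀ s, ‖Y s‖ ≤ ω) →
      (∀ k, 0 ≤ costMatAux A B R (fun s => inflated Q μ (Y s)) N k) ∧
      (∀ k, ‖costMatAux A B R (fun s => inflated Q μ (Y s)) N k‖ ≤ c) ∧
      ∀ k j, ‖transition A B R (costMatAux A B R (fun s => inflated Q μ (Y s)) N) k j‖ ≤
        c * ρ ^ j := by
  have hM : 0 ≤ ‖Q‖ + 4 * μ * ‖Q‖ ^ 2 * ω := by positivity
  obtain ⟨c, ρ, hc, hρ0, hρ1, h⟩ := exists_transition_le hAB hAQ hR hM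
  have hQs := isSymm_of_nonneg hQ
  refine ⟨c, ρ, hc, hρ0, hρ1, fun Y N hY0 hYω => ?_⟩
  obtain ⟨h1, h2⟩ := h (costMatAux A B R (fun s => inflated Q μ (Y s)) N)
    (fun k => inflated Q μ (Y (N - 1 - ((k + 1 : ℕ) : ℤ))))
    (hQ.trans (le_inflated hμ hQs (hY0 _))) (inflated_le hμ hQ (hY0 _) (hYω _))
    (fun k => (sqrt_transpose_mul_sqrt hQ).le.trans (le_inflated hμ hQs (hY0 _)))
    (fun k => inflated_le hμ hQ (hY0 _) (hYω _)) fun k => rfl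
  exact ⟨fun k => (h1 k).1, fun k => norm_le_of_nonneg_of_le hc.le (h1 k).1 (h1 k).2, h2⟩

/-- Existence and convergence for the filter, dual to the control problem. -/
theorem exists_filter_bounds {n m : ℕ} {A : Matrix (Fin n) (Fin n) ℝ}
    {C : Matrix (Fin m) (Fin n) ℝ} {W : Matrix (Fin n) (Fin n) ℝ} {S : Matrix (Fin m) (Fin m) ℝ}
    (hAC : IsDetectable A C) (hAW : IsStabilizable A (CFC.sqrt W)) (hW : 0 ≤ W) (hS : S.PosDef) :
    ∃ Winf, 0 ≤ Winf ∧ IsStabilizingFilter A C W S Winf ∧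
      (∀ X, IsStabilizingFilter A C W S X → X = Winf) ∧
      ∃ c ρ : ℝ, 0 < c ∧ 0 < ρ ∧ ρ < 1 ∧ (∀ k, 0 ≤ filterCovAux A C W S k) ∧
        ∀ k j, ‖filterCovAux A C W S (k + j) - Winf‖ ≤
          c * ρ ^ j * ‖filterCovAux A C W S k - Winf‖ := by
  have hSs := transpose_eq_of_posDef hS
  -- Dualizing stabilizability of (A, W^{1/2}) gives detectability with output matrix (W^{1/2})', so
  -- the lower bound on the penalty is needed in this form.
  have hWW : ((CFC.sqrt W)ᵀ)ᵀ * (CFC.sqrt W)ᵀ ≤ W := by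
    rw [isSymm_of_nonneg (CFC.sqrt_nonneg W), sqrt_transpose_mul_sqrt hW]
  obtain ⟨Winf, h0, hWinf⟩ := exists_stabilizingControl hAC.transpose hAW.transpose hS hWW
  refine ⟨Winf, h0, (isStabilizingFilter_iff hSs).2 hWinf, fun X hX =>
    ((isStabilizingFilter_iff hSs).1 hX).eq hSs hWinf, ?_⟩
  refine hWinf.exists_norm_sub_le hAC.transpose hAW.transpose hS hWW rfl fun k hk => ?_
  exact filterStep_eq (by simpa using isUnit_of_nonneg (B := Cᵀ) hk hS)

/-- The error bounds of the backward recursions, for filter covariances `Y` (depending on the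
initial time `t₀`) that contract towards `Winf`. -/
theorem exists_backward_bounds {n p : ℕ} {A : Matrix (Fin n) (Fin n) ℝ}
    {B : Matrix (Fin n) (Fin p) ℝ} {Q : Matrix (Fin n) (Fin n) ℝ} {R : Matrix (Fin p) (Fin p) ℝ}
    {μ : ℝ} (hμ : 0 ≤ μ) (hAB : IsStabilizable A B) (hAQ : IsDetectable A (CFC.sqrt Q))
    (hQ : 0 ≤ Q) (hR : R.PosDef) (wbar : Fin n → ℝ) {Winf V : Matrix (Fin n) (Fin n) ℝ}
    (hV0 : 0 ≤ V) (hV : IsStabilizingControl A B (inflated Q μ Winf) R V)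
    {Y : ℕ → Matrix (Fin n) (Fin n) ℝ} (hY0 : ∀ k, 0 ≤ Y k) {a r : ℝ} (ha : 0 < a) (hr0 : 0 < r)
    (hr1 : r < 1) (hY : ∀ k j, ‖Y (k + j) - Winf‖ ≤ a * r ^ j * ‖Y k - Winf‖) :
    (∃ C₁ C₂ : ℝ, 0 < C₁ ∧ 0 < C₂ ∧ ∀ t₀ N t : ℤ, t₀ ≤ t → t ≤ N - 1 →
      ‖costMat A B R (fun s => inflated Q μ (Y (s - t₀).toNat)) N t - V‖ ≤
        C₁ * ‖closedLoop A B R V ^ (N - t - 1).toNat‖ + C₂ * ‖Y (t - t₀).toNat - Winf‖) ∧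
    ∃ c ρ : ℝ, 0 < c ∧ 0 < ρ ∧ ρ < 1 ∧ ∀ t₀ N t : ℤ, t₀ ≤ t → t ≤ N - 1 →
      ‖Y (t - t₀).toNat - Winf‖ ≤ c * ρ ^ (t - t₀).toNat ∧
      0 ≤ costMat A B R (fun s => inflated Q μ (Y (s - t₀).toNat)) N t ∧
      ‖costMat A B R (fun s => inflated Q μ (Y (s - t₀).toNat)) N t - V‖ ≤
        c * (ρ ^ (N - 1 - t).toNat + ρ ^ (t - t₀).toNat) ∧
      eucNorm (costVec A B R wbar
          (costMat A B R (fun s => inflated Q μ (Y (s - t₀).toNat)) N) N t -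
          costVecLim A B R wbar V) ≤ c * (ρ ^ (N - 1 - t).toNat + ρ ^ (t - t₀).toNat) := by
  set d := ‖Y 0 - Winf‖ with hd
  have hd0 : 0 ≤ d := norm_nonneg _
  have hYd : ∀ k, ‖Y k - Winf‖ ≤ a * d * r ^ k := fun k => by
    have := hY 0 k
    rw [zero_add] at this
    linarith
  have hYω : ∀ k, ‖Y k‖ ≤ a * d + ‖Winf‖ := fun k => by
    have h1 := norm_add_le (Y k - Winf) Winf
    rw [sub_add_cancel] at h1
    have h2 := (hYd k).trans (mul_le_of_le_one_right (by positivity) (pow_le_one₀ hr0.le hr1.le))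
    linarith
  obtain ⟨c, ρ, hc, hρ0, hρ1, hbd⟩ := exists_costMatAux_bounds hμ hAB hAQ hQ hR
    (by positivity : 0 ≤ a * d + ‖Winf‖)
  obtain ⟨b, θ, hb, hθ0, hθ1, hF⟩ := hV.stable.exists_norm_pow_le
  have hFb : ∀ j, ‖closedLoop A B R V ^ j‖ ≤ b := fun j =>
    (hF j).trans (mul_le_of_le_one_right hb.le (pow_le_one₀ hθ0.le hθ1.le))
  set C₁ := c * (c + ‖V‖) with hC₁
  have hC₁0 : 0 < C₁ := by positivity
  have hρ' : 0 < 1 - ρ := by linarith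
  -- The summand 1 keeps the constant positive when μ = 0.
  set C₂ := c * b * (1 - ρ)⁻¹ * (4 * μ * ‖Q‖ ^ 2 * a) + 1 with hC₂
  have hC₂0 : 0 < C₂ := by positivity
  have main : ∀ t₀ N t : ℤ, t₀ ≤ t → t ≤ N - 1 →
      ‖costMat A B R (fun s => inflated Q μ (Y (s - t₀).toNat)) N t - V‖ ≤
        C₁ * ‖closedLoop A B R V ^ (N - t - 1).toNat‖ + C₂ * ‖Y (t - t₀).toNat - Winf‖ := by
    intro t₀ N t h1 h2
    -- `toNat` freezes the covariance at Y 0 for times before t₀, so the backward sequence is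
    -- defined for all indices and the uniform bounds apply to it.
    obtain ⟨hX0, hXc, hXt⟩ := hbd (fun s => Y (s - t₀).toNat) N (fun s => hY0 _) (fun s => hYω _)
    have e : (N - t - 1).toNat = (N - 1 - t).toNat := by omega
    rw [costMat, e]
    have h3 := hV.norm_riccati_sub_le (X := costMatAux A B R
      (fun s => inflated Q μ (Y (s - t₀).toNat)) N)
      (q := fun k => inflated Q μ (Y (N - 1 - ((k + 1 : ℕ) : ℤ) - t₀).toNat)) hR hX0
      (fun _ => rfl) hc.le hρ0.le hρ1 (D := c + ‖V‖)
      (ω := 4 * μ * ‖Q‖ ^ 2 * (a * ‖Y (t - t₀).toNat - Winf‖)) (by positivity) hXt hFb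
      ((norm_sub_le _ _).trans (add_le_add (hXc 0) le_rfl)) (N - 1 - t).toNat ?_
    · refine h3.trans (add_le_add le_rfl ?_)
      rw [hC₂]
      have := norm_nonneg (Y (t - t₀).toNat - Winf)
      linarith
    · intro i hi
      refine (norm_inflated_sub_le hμ).trans (mul_le_mul_of_nonneg_left ?_ (by positivity))
      -- Penalties with index i < N − 1 − t belong to times at or after t, so their covariance
      -- errors are at most a‖Y_t − Winf‖ by contraction from time t.
      obtain ⟨l, hl⟩ : ∃ l : ℕ, (N - 1 - ((i + 1 : ℕ) : ℤ) - t₀).toNat = (t - t₀).toNat + l :=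
        Nat.exists_eq_add_of_le (by omega)
      rw [hl]
      refine (hY _ l).trans (mul_le_mul_of_nonneg_right ?_ (norm_nonneg _))
      exact mul_le_of_le_one_right ha.le (pow_le_one₀ hr0.le hr1.le)
  refine ⟨⟨C₁, C₂, hC₁0, hC₂0, main⟩, ?_⟩
  -- a common rate, strictly slower than that of the transition matrices
  set m := max ρ (max θ r) with hm
  have hm1 : m < 1 := max_lt hρ1 (max_lt hθ1 hr1)
  set σ := (1 + m) / 2 with hσ
  have hmσ : m < σ := by linarith
  have hσ1 : σ < 1 := by linarith
  have hρσ : ρ < σ := (le_max_left _ _).trans_lt hmσ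
  have hθσ : θ ≤ σ := ((le_max_left _ _).trans (le_max_right _ _)).trans hmσ.le
  have hrσ : r ≤ σ := ((le_max_right _ _).trans (le_max_right _ _)).trans hmσ.le
  have hσ0 : 0 < σ := hρ0.trans hρσ
  have hYσ : ∀ k, ‖Y k - Winf‖ ≤ a * d * σ ^ k := fun k =>
    (hYd k).trans (mul_le_mul_of_nonneg_left (pow_le_pow_left₀ hr0.le hrσ k) (by positivity))
  set G := C₁ * b + C₂ * (a * d) with hG
  have hG0 : 0 < G := by positivity
  have hVσ : ∀ t₀ N t : ℤ, t₀ ≤ t → t ≤ N - 1 →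
      ‖costMat A B R (fun s => inflated Q μ (Y (s - t₀).toNat)) N t - V‖ ≤
        G * (σ ^ (N - 1 - t).toNat + σ ^ (t - t₀).toNat) := by
    intro t₀ N t h1 h2
    refine (main t₀ N t h1 h2).trans ?_
    have e : (N - t - 1).toNat = (N - 1 - t).toNat := by omega
    rw [e]
    have h3 : ‖closedLoop A B R V ^ (N - 1 - t).toNat‖ ≤ b * σ ^ (N - 1 - t).toNat :=
      (hF _).trans (mul_le_mul_of_nonneg_left (pow_le_pow_left₀ hθ0.le hθσ _) hb.le)
    have h4 := mul_le_mul_of_nonneg_left h3 hC₁0.le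
    have h5 := mul_le_mul_of_nonneg_left (hYσ (t - t₀).toNat) hC₂0.le
    have h6 : 0 ≤ C₁ * b * σ ^ (t - t₀).toNat + C₂ * (a * d) * σ ^ (N - 1 - t).toNat := by
      positivity
    rw [hG]
    linarith
  obtain ⟨L, hL0, hL⟩ := exists_norm_gain_sub_le (A := A) (B := B) hR hV0
  set ξ := costVecLim A B R wbar V with hξ
  set z := ξ + V *ᵥ wbar with hz
  set H := c * eucNorm wbar + ‖B‖ * L * eucNorm z with hH
  have hw0 := eucNorm_nonneg wbar
  have hz0 := eucNorm_nonneg z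
  have hξ0 := eucNorm_nonneg ξ
  have hH0 : 0 ≤ H := by positivity
  have hσρ : 0 < σ - ρ := by linarith
  set c' := a * d + G + c * (eucNorm ξ + H * G * ((σ - ρ)⁻¹ + (1 - ρ)⁻¹)) with hc'
  have hc1 : a * d ≤ c' := by
    have : 0 ≤ c * (eucNorm ξ + H * G * ((σ - ρ)⁻¹ + (1 - ρ)⁻¹)) := by positivity
    linarith
  have hc2 : G ≤ c' := by
    have : 0 ≤ c * (eucNorm ξ + H * G * ((σ - ρ)⁻¹ + (1 - ρ)⁻¹)) := by positivity
    have : 0 ≤ a * d := by positivity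
    linarith
  have hc3 : c * (eucNorm ξ + H * G * ((σ - ρ)⁻¹ + (1 - ρ)⁻¹)) ≤ c' := by
    have : 0 ≤ a * d := by positivity
    linarith
  refine ⟨c', σ, hG0.trans_le hc2, hσ0, hσ1, fun t₀ N t h1 h2 => ⟨?_, ?_, ?_, ?_⟩⟩
  · exact (hYσ _).trans (mul_le_mul_of_nonneg_right hc1 (by positivity))
  · exact (hbd (fun s => Y (s - t₀).toNat) N (fun s => hY0 _) (fun s => hYω _)).1 _
  · exact (hVσ t₀ N t h1 h2).trans (mul_le_mul_of_nonneg_right hc2 (by positivity))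
  · obtain ⟨hX0, hXc, hXt⟩ := hbd (fun s => Y (s - t₀).toNat) N (fun s => hY0 _) (fun s => hYω _)
    set X := costMatAux A B R (fun s => inflated Q μ (Y (s - t₀).toNat)) N with hX
    have hcm : ∀ k : ℕ, costMat A B R (fun s => inflated Q μ (Y (s - t₀).toNat)) N (N - 1 - k) =
        X k := by
      intro k
      have e : (N - 1 - (N - 1 - (k : ℤ))).toNat = k := by omega
      rw [costMat, e]
    set x := costVecAux A B R wbar
      (costMat A B R (fun s => inflated Q μ (Y (s - t₀).toNat)) N) N with hx
    -- Subtracting the stationary equation ξ = F'z, with z = ξ + V wbar, leaves a linear recursion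
    -- whose forcing is linear in X_k − V and in the difference of the closed loops.
    have hrec : ∀ k, x (k + 1) - ξ = (closedLoop A B R (X k))ᵀ *ᵥ (x k - ξ) +
        ((closedLoop A B R (X k))ᵀ *ᵥ ((X k - V) *ᵥ wbar) +
          (closedLoop A B R (X k) - closedLoop A B R V)ᵀ *ᵥ z) := by
      intro k
      have h3 : x (k + 1) = (closedLoop A B R (X k))ᵀ *ᵥ (x k + X k *ᵥ wbar) := by
        rw [hx, costVecAux, hcm]
      have h4 : ξ = (closedLoop A B R V)ᵀ *ᵥ z := costVecLim_eq hV.stable wbar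
      rw [h3]
      nth_rw 1 [h4]
      rw [hz, Matrix.transpose_sub]
      simp only [Matrix.mulVec_add, Matrix.mulVec_sub, Matrix.sub_mulVec]
      abel
    have hτ : 0 ≤ σ ^ (t - t₀).toNat := by positivity
    have h5 := eucNorm_affine_recursion_le (e := fun k => x k - ξ) hrec hc.le hρ0.le hρσ hσ1
      (mul_nonneg hH0 hG0.le) hXt hτ (N - 1 - t).toNat ?_
    · have h6 : x 0 - ξ = -ξ := by rw [hx, costVecAux, zero_sub]
      simp only [h6, eucNorm_neg] at h5
      exact h5.trans (mul_le_mul_of_nonneg_right hc3 (by positivity))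
    · intro i hi
      have h6 : ‖X i - V‖ ≤ G * (σ ^ i + σ ^ (t - t₀).toNat) := by
        have h7 := hVσ t₀ N (N - 1 - i) (by omega) (by omega)
        rw [hcm] at h7
        have e : (N - 1 - (N - 1 - (i : ℤ))).toNat = i := by omega
        rw [e] at h7
        refine h7.trans (mul_le_mul_of_nonneg_left (add_le_add le_rfl ?_) hG0.le)
        -- The time N − 1 − i is not before t, so its forward error is dominated by the one at t;
        -- this fixed quantity plays the role of τ.
        exact pow_le_pow_of_le_one hσ0.le hσ1.le (by omega)
      have h7 : ‖closedLoop A B R (X i)‖ ≤ c := by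
        have h8 := hXt i 1
        simp only [transition, Matrix.one_mul, add_zero] at h8
        exact h8.trans (mul_le_of_le_one_right hc.le (pow_le_one₀ hρ0.le hρ1.le))
      have h9 : ‖closedLoop A B R (X i) - closedLoop A B R V‖ ≤ ‖B‖ * (L * ‖X i - V‖) := by
        rw [closedLoop, closedLoop, add_sub_add_left_eq_sub, ← Matrix.mul_sub]
        exact (Matrix.l2_opNorm_mul _ _).trans
          (mul_le_mul_of_nonneg_left (hL _ (hX0 i)) (norm_nonneg _))
      have h10 : eucNorm ((closedLoop A B R (X i))ᵀ *ᵥ ((X i - V) *ᵥ wbar)) ≤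
          c * (‖X i - V‖ * eucNorm wbar) := by
        refine (eucNorm_mulVec_le _ _).trans ?_
        rw [norm_transpose]
        exact mul_le_mul h7 (eucNorm_mulVec_le _ _) (eucNorm_nonneg _) hc.le
      have h11 : eucNorm ((closedLoop A B R (X i) - closedLoop A B R V)ᵀ *ᵥ z) ≤
          ‖B‖ * (L * ‖X i - V‖) * eucNorm z := by
        refine (eucNorm_mulVec_le _ _).trans ?_
        rw [norm_transpose]
        exact mul_le_mul_of_nonneg_right h9 hz0
      refine (eucNorm_add_le _ _).trans ((add_le_add h10 h11).trans ?_)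
      have h12 := mul_le_mul_of_nonneg_left h6 hH0
      rw [hH] at h12 ⊢
      linarith

end RiskLQG

/-! ### Assembly of the theorem -/

theorem mainTheorem4 {n p m : ℕ}
    (A : Matrix (Fin n) (Fin n) ℝ) (B : Matrix (Fin n) (Fin p) ℝ) (C : Matrix (Fin m) (Fin n) ℝ)
    (Q : Matrix (Fin n) (Fin n) ℝ) (R : Matrix (Fin p) (Fin p) ℝ) (μ : ℝ) (hμ : 0 ≤ μ)
    -- Gaussian noise
    {Ω : Type*} [MeasurableSpace Ω] (P : MeasureTheory.Measure Ω)
    [MeasureTheory.IsProbabilityMeasure P]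
    (w : ℤ → Ω → (Fin n → ℝ)) (v : ℤ → Ω → (Fin m → ℝ)) (wbar : Fin n → ℝ)
    (W : Matrix (Fin n) (Fin n) ℝ) (S : Matrix (Fin m) (Fin m) ℝ)
    (hnoise : RiskLQG.IsGaussianNoise P w v wbar W S)
    -- controllability
    (hAB : RiskLQG.IsStabilizable A B) (hAQ : RiskLQG.IsDetectable A (CFC.sqrt Q))
    (hQ : Q.PosDef) (hR : R.PosDef)
    -- observability
    (hAC : RiskLQG.IsDetectable A C) (hAW : RiskLQG.IsStabilizable A (CFC.sqrt W))
    (hS : S.PosDef) :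
    -- the stabilizing solutions exist and are unique
    (∃! X, RiskLQG.IsStabilizingFilter A C W S X) ∧
    ∀ Winf, RiskLQG.IsStabilizingFilter A C W S Winf →
    (∃! X, RiskLQG.IsStabilizingControl A B (RiskLQG.inflated Q μ Winf) R X) ∧
    ∀ V, RiskLQG.IsStabilizingControl A B (RiskLQG.inflated Q μ Winf) R V →
    let Wt : ℤ → ℤ → Matrix (Fin n) (Fin n) ℝ := fun t₀ t => RiskLQG.filterCov A C W S t₀ t
    let Vt : ℤ → ℤ → ℤ → Matrix (Fin n) (Fin n) ℝ := fun t₀ N t =>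
      RiskLQG.costMat A B R (fun s => RiskLQG.inflated Q μ (Wt t₀ s)) N t
    let ξt : ℤ → ℤ → ℤ → (Fin n → ℝ) := fun t₀ N t =>
      RiskLQG.costVec A B R wbar (Vt t₀ N) N t
    let K : Matrix (Fin p) (Fin n) ℝ := RiskLQG.gain A B R V
    let ξ : Fin n → ℝ := RiskLQG.costVecLim A B R wbar V
    -- stability of the closed loop
    RiskLQG.IsStable (A + B * K) ∧
    -- the finite-time error bound
    (∃ C₁ C₂ : ℝ, 0 < C₁ ∧ 0 < C₂ ∧ ∀ t₀ N t : ℤ, t₀ ≤ t → t ≤ N - 1 →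
      ‖Vt t₀ N t - V‖ ≤ C₁ * ‖(A + B * K) ^ (N - t - 1).toNat‖ + C₂ * ‖Wt t₀ t - Winf‖) ∧
    -- exponential convergence as `N → ∞` and `t₀ → -∞`
    (∃ c ρ : ℝ, 0 < c ∧ 0 < ρ ∧ ρ < 1 ∧ ∀ t₀ N t : ℤ, t₀ ≤ t → t ≤ N - 1 →
      ‖Wt t₀ t - Winf‖ ≤ c * ρ ^ (t - t₀).toNat ∧
      ‖Vt t₀ N t - V‖ ≤ c * (ρ ^ (N - 1 - t).toNat + ρ ^ (t - t₀).toNat) ∧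
      ‖RiskLQG.gain A B R (Vt t₀ N t) - K‖ ≤
        c * (ρ ^ (N - 1 - t).toNat + ρ ^ (t - t₀).toNat) ∧
      RiskLQG.eucNorm (ξt t₀ N t - ξ) ≤ c * (ρ ^ (N - 1 - t).toNat + ρ ^ (t - t₀).toNat) ∧
      -- the affine term, both as `-(B'VB + R)⁻¹ B' ξ` and as `-(B'VB + R)⁻¹ B' (ξ + V wbar)`
      RiskLQG.eucNorm (RiskLQG.affineTerm B R (Vt t₀ N t) (ξt t₀ N t) -
          RiskLQG.affineTerm B R V ξ) ≤ c * (ρ ^ (N - 1 - t).toNat + ρ ^ (t - t₀).toNat) ∧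
      RiskLQG.eucNorm (RiskLQG.affineTerm B R (Vt t₀ N t) (ξt t₀ N t + Vt t₀ N t *ᵥ wbar) -
          RiskLQG.affineTerm B R V (ξ + V *ᵥ wbar)) ≤
        c * (ρ ^ (N - 1 - t).toNat + ρ ^ (t - t₀).toNat)) := by
  have hW : 0 ≤ W := hnoise.cov_nonneg
  have hQ0 : 0 ≤ Q := Matrix.nonneg_iff_posSemidef.2 hQ.posSemidef
  have hRs := RiskLQG.transpose_eq_of_posDef hR
  obtain ⟨W₀, hW₀0, hW₀, huniq, a, r, ha, hr0, hr1, hWt0, hWt⟩ :=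
    RiskLQG.exists_filter_bounds hAC hAW hW hS
  refine ⟨⟨W₀, hW₀, huniq⟩, fun Winf hWinf => ?_⟩
  -- Uniqueness identifies the given solution with the constructed one and thereby supplies its
  -- nonnegativity, which is not part of being stabilizing. The same device is used for V below.
  obtain rfl := huniq Winf hWinf
  -- Detectability through Q^{1/2} suffices for the inflated penalty, since only the lower bound Q ≤
  -- Q_{μ,∞} enters.
  obtain ⟨V₀, hV₀0, hV₀⟩ := RiskLQG.exists_stabilizingControl hAB hAQ hR
    ((RiskLQG.sqrt_transpose_mul_sqrt hQ0).le.trans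
      (RiskLQG.le_inflated hμ (RiskLQG.isSymm_of_nonneg hQ0) hW₀0))
  refine ⟨⟨V₀, hV₀, fun V hV => hV.eq hRs hV₀⟩, fun V hV => ?_⟩
  obtain rfl := hV.eq hRs hV₀
  obtain ⟨hfin, c, ρ, hc, hρ0, hρ1, hconv⟩ := RiskLQG.exists_backward_bounds hμ hAB hAQ hQ0 hR wbar
    hV₀0 hV hWt0 ha hr0 hr1 hWt
  refine ⟨hV.stable, hfin, ?_⟩
  obtain ⟨L₁, hL₁, hgain⟩ := RiskLQG.exists_norm_gain_sub_le (A := A) (B := B) hR hV₀0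
  obtain ⟨L₂, hL₂, haff⟩ := RiskLQG.exists_eucNorm_affineTerm_sub_le (B := B) hR hV₀0
    (RiskLQG.costVecLim A B R wbar V)
  obtain ⟨L₃, hL₃, haff'⟩ := RiskLQG.exists_eucNorm_affineTerm_sub_le (B := B) hR hV₀0
    (RiskLQG.costVecLim A B R wbar V + V *ᵥ wbar)
  have hw := RiskLQG.eucNorm_nonneg wbar
  -- The summands cover, in turn, W_t, V_t and ξ_t (all by c), the gain, and the two affine terms;
  -- the last one also carries the error of V_t wbar.
  set c' := c + L₁ * c + L₂ * (2 * c) + L₃ * (c + c * RiskLQG.eucNorm wbar + c) with hc'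
  have hp1 : 0 ≤ L₁ * c := by positivity
  have hp2 : 0 ≤ L₂ * (2 * c) := by positivity
  have hp3 : 0 ≤ L₃ * (c + c * RiskLQG.eucNorm wbar + c) := by positivity
  refine ⟨c', ρ, by positivity, hρ0, hρ1, fun t₀ N t h1 h2 => ?_⟩
  obtain ⟨hWc, hV0, hVc, hξc⟩ := hconv t₀ N t h1 h2
  have hE : 0 ≤ ρ ^ (N - 1 - t).toNat + ρ ^ (t - t₀).toNat := by positivity
  refine ⟨hWc.trans (mul_le_mul_of_nonneg_right (by linarith) (by positivity)),
    hVc.trans (mul_le_mul_of_nonneg_right (by linarith) hE), ?_,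
    hξc.trans (mul_le_mul_of_nonneg_right (by linarith) hE), ?_, ?_⟩
  · refine (hgain _ hV0).trans ((mul_le_mul_of_nonneg_left hVc hL₁.le).trans ?_)
    rw [← mul_assoc]
    exact mul_le_mul_of_nonneg_right (by linarith) hE
  · refine (haff _ hV0 _).trans ((mul_le_mul_of_nonneg_left (add_le_add hξc hVc) hL₂.le).trans ?_)
    rw [← two_mul, ← mul_assoc 2, ← mul_assoc]
    exact mul_le_mul_of_nonneg_right (by linarith) hE
  · refine (haff' _ hV0 _).trans ?_
    have h3 : ∀ x ξ y z : Fin n → ℝ, x + y - (ξ + z) = (x - ξ) + (y - z) := fun _ _ _ _ => by abel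
    rw [h3, ← Matrix.sub_mulVec]
    have h4 := (RiskLQG.eucNorm_mulVec_le (_ - V) wbar).trans (mul_le_mul_of_nonneg_right hVc hw)
    refine (mul_le_mul_of_nonneg_left (add_le_add ((RiskLQG.eucNorm_add_le _ _).trans
      (add_le_add hξc h4)) hVc) hL₃.le).trans ?_
    have h5 := mul_le_mul_of_nonneg_right
      (show L₃ * (c + c * RiskLQG.eucNorm wbar + c) ≤ c' by linarith) hE
    linarith
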